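/- Let $A$ be a finite subset of $\mathbb Z^2$ such that $(i,-j)\in A$ whenever $(i,j)\in A$ (symmetry) and $|j|\le 1$ for all $(i,j)\in A$ (small height variations). For $(i,j)\in\mathbb Z^2$ and $n\ge 0$ let $a_{i,j}(n)$ be the number of walks $(w_0,\dots,w_n)$ in $\mathbb Z^2$ with $w_0=(0,0)$, $w_n=(i,j)$, $w_k-w_{k-1}\in A$ and $w_k\notin\mathcal H=\{(m,0):m\le 0\}$ for $1\le k\le n$. Put $\bar x=1/x$, $$A_0(x)=\sum_{(i,0)\in A}x^i,\qquad A_1(x)=\sum_{(i,1)\in A}x^i,\qquad \delta(x)=(1-tA_0(x)-2tA_1(x))(1-tA_0(x)+2tA_1(x)).$$ There is a unique triple $(D,\Delta,\bar\Delta)\in\mathbb R[[t]]\times\mathbb R[x][[t]]\times\mathbb R[\bar x][[t]]$ such that $\delta(x)=D(t)\,\Delta(x;t)\,\bar\Delta(\bar x;t)$ and $D(0)=\Delta(0;t)=\bar\Delta(0;t)=\Delta(x;0)=\bar\Delta(\bar x;0)=1$. Square roots of series with constant term $1$ in $t$ are taken with constant term $1$. Let $\mathbb Q_A\subset\mathbb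 C((t))$ be the extension of $\mathbb Q(t)$ generated by $\sqrt D$, the coefficients (series in $t$) of $\Delta$ and $\bar\Delta$ as polynomials in $x$ and $\bar x$, the nonzero complex roots $\alpha$ of $A_1$, and the series $\sqrt{\Delta(\alpha;t)}$ for these roots (if $A_1=0$ there are no roots to adjoin). Then $\mathbb Q_A$ is a finite extension of $\mathbb Q(t)$. For $j\ge 0$ let $$f_j^+=\sum_{k=0}^{\lfloor j/2\rfloor}\binom{j}{2k}\delta(x)^k(1-tA_0(x))^{j-2k},\qquad f_j^-=\sum_{k=0}^{\lfloor (j-1)/2\rfloor}\binom{j}{2k+1}\delta(x)^k(1-tA_0(x))^{j-2k-1}.$$ Then, for every $j\ge0$, there is a Laurent polynomial $g_j(x;t)$ in $x$ with coefficients in $\mathbb Q_A$ such that $$S_j^+(x;t)=\sum_{n\ge0}\sum_{i\ge0}a_{i,j}(n)x^it^n=\frac{1}{(2tA_1(x))^j}\left(\frac{f_j^+(x;t)}{\sqrt{\Delta(x;t)}}-g_j(x;t)\right),$$ $$S_j^-(x;t)=\sum_{n\ge0}\sum_{i<0}a_{i,j}(n)x^it^n=\frac{1}{(2tA_1(x))^j}\left(g_j(x;t)-f_j^-(x;t)\sqrt{D(t)\bar\Delta(\bar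 x;t)}\right).$$ These are identities in $\mathbb C(x)((t))$; if $A_1=0$ they hold after multiplication by $(2tA_1(x))^j$. Consequently, for every $(i,j)\in\mathbb Z^2$, the series $S_{i,j}(t)=\sum_{n\ge0}a_{i,j}(n)t^n$ belongs to $\mathbb Q_A$, and is algebraic over $\mathbb Q(t)$. -/

import Mathlib

namespace SlitPlane

noncomputable section

/-! ### Walks on the slit plane -/

/-- The forbidden half-line `{(k,0) : k ≤ 0}`. -/
def halfLine : Set (ℤ × ℤ) := {p | p.1 ≤ 0 ∧ p.2 = 0}

/-- Invariance of the step set under `(i,j) ↦ (i,-j)`. -/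
def Symmetric (A : Finset (ℤ × ℤ)) : Prop :=
  ∀ i j : ℤ, (i, j) ∈ A → (i, -j) ∈ A

/-- Every step changes the ordinate by at most one. -/
def SmallHeightVariations (A : Finset (ℤ × ℤ)) : Prop :=
  ∀ i j : ℤ, (i, j) ∈ A → |j| ≤ 1

/-- Walks `w₀, …, wₙ` of length `n` with steps in `A`, from `(0,0)` to `(i,j)`, none of whose
vertices `w₁, …, wₙ` lies on the forbidden half-line. -/
def slitWalks (A : Finset (ℤ × ℤ)) (i j : ℤ) (n : ℕ) : Set (Fin (n + 1) → ℤ × ℤ) :=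
  {w | w 0 = (0, 0) ∧ w (Fin.last n) = (i, j) ∧
    (∀ k : Fin n, w k.succ - w k.castSucc ∈ A) ∧ ∀ k : Fin n, w k.succ ∉ halfLine}

/-- The number `a_{i,j}(n)` of walks on the slit plane of length `n` ending at `(i,j)`. -/
def count (A : Finset (ℤ × ℤ)) (i j : ℤ) (n : ℕ) : ℕ := (slitWalks A i j n).ncard

/-- The walks of length `n` with steps in `A` starting from the origin. -/
def freeWalks (A : Finset (ℤ × ℤ)) (n : ℕ) : Set (Fin (n + 1) → ℤ × ℤ) :=
  {w | w 0 = (0, 0) ∧ ∀ k : Fin n, w k.succ - w k.castSucc ∈ A}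

theorem freeWalks_finite (A : Finset (ℤ × ℤ)) (n : ℕ) : (freeWalks A n).Finite := by
  have hfin : (Set.univ.pi (fun _ : Fin n => (A : Set (ℤ × ℤ)))).Finite :=
    Set.Finite.pi' (fun _ => A.finite_toSet) |>.subset (fun f hf k => hf k trivial)
  refine Set.Finite.of_finite_image (f := fun w (k : Fin n) => w k.succ - w k.castSucc)
    (hfin.subset ?_) ?_
  · rintro _ ⟨w, hw, rfl⟩ k _
    exact hw.2 k
  · intro w hw v hv h
    funext k
    induction k using Fin.induction with
    | zero => rw [hw.1, hv.1]
    | succ k ih =>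
      have := congrFun h k
      simp only [ih] at this
      exact sub_left_injective this

theorem slitWalks_finite (A : Finset (ℤ × ℤ)) (i j : ℤ) (n : ℕ) : (slitWalks A i j n).Finite :=
  (freeWalks_finite A n).subset fun _ hw => ⟨hw.1, hw.2.2.1⟩

/-- For fixed `j` and `n`, only finitely many abscissae are reached, so that the sums over `i`
below are finite sums. -/
theorem count_support_finite (A : Finset (ℤ × ℤ)) (j : ℤ) (n : ℕ) :
    {i : ℤ | count A i j n ≠ 0}.Finite := by
  refine ((freeWalks_finite A n).image (fun w => (w (Fin.last n)).1)).subset ?_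
  intro i hi
  obtain ⟨w, hw⟩ := Set.nonempty_of_ncard_ne_zero hi
  exact ⟨w, ⟨hw.1, hw.2.2.1⟩, by simp [hw.2.1]⟩

/-! ### Square roots of formal power series -/

/-- The square root, with constant term `1`, of a power series `F` with constant term `1`,
given by the binomial expansion `√F = ∑ₖ (1/2 choose k) (F - 1)ᵏ`. -/
def sqrtSeries {R : Type*} [CommRing R] [Algebra ℚ R] (F : PowerSeries R) : PowerSeries R :=
  (PowerSeries.binomialSeries R (1 / 2 : ℚ)).subst (F - 1)

theorem hasSubst_sub_one {R : Type*} [CommRing R] {F : PowerSeries R}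
    (h : PowerSeries.constantCoeff F = 1) : PowerSeries.HasSubst (F - 1) :=
  PowerSeries.HasSubst.of_constantCoeff_zero' (by simp [h])

theorem sqrtSeries_sq {R : Type*} [CommRing R] [Algebra ℚ R] {F : PowerSeries R}
    (h : PowerSeries.constantCoeff F = 1) : sqrtSeries F ^ 2 = F := by
  have hs := hasSubst_sub_one h
  have h1 : PowerSeries.binomialSeries R (1 / 2 : ℚ) * PowerSeries.binomialSeries R (1 / 2 : ℚ)
      = 1 + PowerSeries.X := by
    rw [← PowerSeries.binomialSeries_add]
    have := PowerSeries.binomialSeries_nat (R := ℚ) (A := R) 1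
    norm_num at this ⊢
    exact this
  rw [sqrtSeries, pow_two, ← PowerSeries.subst_mul hs, h1, PowerSeries.subst_add hs,
    PowerSeries.subst_X hs, ← PowerSeries.coe_substAlgHom hs, map_one]
  ring

/-! ### The ambient fields `ℂ((t))` and `ℂ(x)((t))` -/

/-- The field `ℂ((t))`. -/
abbrev SeriesT : Type := LaurentSeries ℂ

/-- The field `ℂ(x)((t))`, in which all identities between series in `x` and `t` take place. -/
abbrev SeriesXT : Type := LaurentSeries (RatFunc ℂ)

/-- The variable `t` of `ℂ((t))`. -/
def tT : SeriesT := HahnSeries.single 1 1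

/-- The variable `t` of `ℂ(x)((t))`. -/
def t : SeriesXT := HahnSeries.single 1 1

/-- The variable `x` of `ℂ(x)((t))`. -/
def x : SeriesXT := HahnSeries.C RatFunc.X

/-- The inclusion of `ℂ((t))` in `ℂ(x)((t))`. -/
def inclT (c : SeriesT) : SeriesXT := HahnSeries.map c (RatFunc.C : ℂ →+* RatFunc ℂ)

/-- The inclusion of `ℝ[[t]]` in `ℂ((t))`. -/
def ofRealSeries (F : PowerSeries ℝ) : SeriesT :=
  ((PowerSeries.map Complex.ofRealHom F : PowerSeries ℂ) : LaurentSeries ℂ)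

/-- For `F(z;t)` in `ℝ[z][[t]]` and `r` in `ℂ(x)`, the series `F(r;t)` in `ℂ(x)((t))`. -/
def substX (r : RatFunc ℂ) (F : PowerSeries (Polynomial ℝ)) : SeriesXT :=
  ((PowerSeries.map (Polynomial.eval₂RingHom (RatFunc.C.comp Complex.ofRealHom) r) F :
    PowerSeries (RatFunc ℂ)) : LaurentSeries (RatFunc ℂ))

/-- For `F(z;t)` in `ℝ[z][[t]]` and `α` in `ℂ`, the series `F(α;t)` in `ℂ[[t]]`. -/
def evalAt (α : ℂ) (F : PowerSeries (Polynomial ℝ)) : PowerSeries ℂ :=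
  PowerSeries.map (Polynomial.eval₂RingHom Complex.ofRealHom α) F

/-- The coefficient of `zᵏ`, a series in `t`, of `F(z;t)` in `ℝ[z][[t]]`. -/
def xCoeff (k : ℕ) (F : PowerSeries (Polynomial ℝ)) : PowerSeries ℝ :=
  PowerSeries.mk fun n => (PowerSeries.coeff n F).coeff k

/-! ### The Laurent polynomials attached to the step set -/

/-- `A₀(x) = ∑_{(i,0) ∈ A} xⁱ`. -/
def A₀ (A : Finset (ℤ × ℤ)) : SeriesXT := ∑ s ∈ A with s.2 = 0, x ^ s.1

/-- `A₁(x) = ∑_{(i,1) ∈ A} xⁱ`. -/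
def A₁ (A : Finset (ℤ × ℤ)) : SeriesXT := ∑ s ∈ A with s.2 = 1, x ^ s.1

/-- `δ(x;t) = (1 - t A₀ - 2 t A₁)(1 - t A₀ + 2 t A₁)`. -/
def delta (A : Finset (ℤ × ℤ)) : SeriesXT :=
  (1 - t * A₀ A - 2 * t * A₁ A) * (1 - t * A₀ A + 2 * t * A₁ A)

/-- The roots of the polynomial `x^m A₁(x)`, where `m` is the smallest integer for which this is
a polynomial, i.e. the nonzero complex roots of `A₁` (none if `A₁ = 0`). -/
def rootsA₁ (A : Finset (ℤ × ℤ)) : Set ℂ :=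
  {α | A₁ A ≠ 0 ∧ α ≠ 0 ∧ ∑ s ∈ A with s.2 = 1, α ^ s.1 = 0}

/-- `f_j⁺ = ∑_{0 ≤ k ≤ ⌊j/2⌋} (j choose 2k) δᵏ (1 - t A₀)^(j-2k)`. -/
def fPlus (A : Finset (ℤ × ℤ)) (j : ℕ) : SeriesXT :=
  ∑ k ∈ Finset.range (j / 2 + 1),
    (j.choose (2 * k) : SeriesXT) * delta A ^ k * (1 - t * A₀ A) ^ (j - 2 * k)

/-- `f_j⁻ = ∑_{0 ≤ k ≤ ⌊(j-1)/2⌋} (j choose 2k+1) δᵏ (1 - t A₀)^(j-2k-1)`; the condition on `k`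
is `2k + 1 ≤ j`, and `f_0⁻ = 0`. -/
def fMinus (A : Finset (ℤ × ℤ)) (j : ℕ) : SeriesXT :=
  ∑ k ∈ Finset.range ((j + 1) / 2),
    (j.choose (2 * k + 1) : SeriesXT) * delta A ^ k * (1 - t * A₀ A) ^ (j - 2 * k - 1)

/-! ### The canonical factorization -/

/-- A triple `(D(t), Δ(x;t), Δ̄(x̄;t))` in `ℝ[[t]] × ℝ[x][[t]] × ℝ[x̄][[t]]`, where `x̄ = 1/x`. -/
structure Triple where
  D : PowerSeries ℝ
  Delta : PowerSeries (Polynomial ℝ)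
  DeltaBar : PowerSeries (Polynomial ℝ)

/-- The triple is the canonical factorization of `δ(x;t)`: one has `δ(x) = D Δ(x) Δ̄(x̄)` and
`D(0) = Δ(0;t) = Δ̄(0;t) = Δ(x;0) = Δ̄(x̄;0) = 1`. -/
structure IsCanonicalFactorization (A : Finset (ℤ × ℤ)) (F : Triple) : Prop where
  factor : delta A =
    inclT (ofRealSeries F.D) * substX RatFunc.X F.Delta * substX (RatFunc.X)⁻¹ F.DeltaBar
  D_zero : PowerSeries.constantCoeff F.D = 1
  Delta_x_zero : PowerSeries.map (Polynomial.evalRingHom 0) F.Delta = 1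
  DeltaBar_x_zero : PowerSeries.map (Polynomial.evalRingHom 0) F.DeltaBar = 1
  Delta_t_zero : PowerSeries.constantCoeff F.Delta = 1
  DeltaBar_t_zero : PowerSeries.constantCoeff F.DeltaBar = 1

/-- `√(Δ(x;t))`. -/
def sqrtDelta (F : Triple) : SeriesXT := substX RatFunc.X (sqrtSeries F.Delta)

/-- `√(D(t) Δ̄(x̄;t))`. -/
def sqrtDDeltaBar (F : Triple) : SeriesXT :=
  substX (RatFunc.X)⁻¹ (sqrtSeries (PowerSeries.map Polynomial.C F.D * F.DeltaBar))

/-! ### The field `ℚ_A` -/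

/-- The field `ℚ(t)`, as a subfield of `ℂ((t))`. -/
def QT : IntermediateField ℚ SeriesT := IntermediateField.adjoin ℚ {tT}

/-- The extension `ℚ_A` of `ℚ(t)` generated by `√D`, the coefficients of `Δ` and `Δ̄` (as
polynomials in `x` and `x̄`), the roots `α` of `A₁`, and the series `√(Δ(α;t))`. -/
def QA (A : Finset (ℤ × ℤ)) (F : Triple) : IntermediateField QT SeriesT :=
  IntermediateField.adjoin QT
    ({ofRealSeries (sqrtSeries F.D)} ∪
      Set.range (fun k => ofRealSeries (xCoeff k F.Delta)) ∪
      Set.range (fun k => ofRealSeries (xCoeff k F.DeltaBar)) ∪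
      (fun α : ℂ => (HahnSeries.C α : SeriesT)) '' rootsA₁ A ∪
      (fun α : ℂ => ((sqrtSeries (evalAt α F.Delta) : PowerSeries ℂ) : LaurentSeries ℂ)) ''
        rootsA₁ A)

/-- The element of `ℂ(x)((t))` given by a Laurent polynomial in `x` with coefficients in `ℚ_A`. -/
def ofLaurentPoly {A : Finset (ℤ × ℤ)} {F : Triple} (g : LaurentPolynomial (QA A F)) : SeriesXT :=
  ∑ i ∈ g.coeff.support, inclT (g.coeff i : SeriesT) * x ^ i

/-! ### The generating functions -/

/-- `S_j⁺(x;t) = ∑_{n ≥ 0} ∑_{i ≥ 0} a_{i,j}(n) xⁱ tⁿ`. -/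
def SPlus (A : Finset (ℤ × ℤ)) (j : ℤ) : SeriesXT :=
  ((PowerSeries.mk fun n => ∑ᶠ i ∈ {i : ℤ | 0 ≤ i}, (count A i j n : RatFunc ℂ) * RatFunc.X ^ i :
    PowerSeries (RatFunc ℂ)) : LaurentSeries (RatFunc ℂ))

/-- `S_j⁻(x;t) = ∑_{n ≥ 0} ∑_{i < 0} a_{i,j}(n) xⁱ tⁿ`. -/
def SMinus (A : Finset (ℤ × ℤ)) (j : ℤ) : SeriesXT :=
  ((PowerSeries.mk fun n => ∑ᶠ i ∈ {i : ℤ | i < 0}, (count A i j n : RatFunc ℂ) * RatFunc.X ^ i :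
    PowerSeries (RatFunc ℂ)) : LaurentSeries (RatFunc ℂ))

/-- `S_{i,j}(t) = ∑_{n ≥ 0} a_{i,j}(n) tⁿ`. -/
def S (A : Finset (ℤ × ℤ)) (i j : ℤ) : SeriesT :=
  ((PowerSeries.mk fun n => (count A i j n : ℂ) : PowerSeries ℂ) : LaurentSeries ℂ)

end

end SlitPlane

/-! Write `L = 1 - tA₀`, `T = 2tA₁`, so that `δ = L² - T²`, and let `S_j` be the series of walks
ending at height `j`. Removing the last step gives `2L S_j = T(S_{j-1} + S_{j+1})` for `j ≠ 0`. The
characteristic root divisible by `t` is `L - √δ` (after scaling by `T`), and `t`-adic convergence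
selects it: `Tʲ S_j = (L - √δ)ʲ S_0` (`twoTA₁_pow_mul_walkSeries`). On the axis the same
decomposition also produces walks that end on the half-line; these must be subtracted and form a
series `B(x̄)`. Hence `√δ S_0 = 1 - B(x̄)`. With `√δ = √Δ(x) √(DΔ̄(x̄))`, the product `√Δ S_0` has
only nonnegative exponents of `x` and equals `(1 - B)/√(DΔ̄)`, which has only nonpositive ones; so
it is free of `x`, and `x = 0` gives `S_0 = 1/√Δ` (`posEmb_rootPos_mul_walkSeries`). Expanding the
power yields `Tʲ S_j = f_j⁺/√Δ - f_j⁻ √(DΔ̄)`.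

Splitting `S_j = S_j⁺ + S_j⁻`, set `g = f_j⁺/√Δ - Tʲ S_j⁺ = f_j⁻ √(DΔ̄) + Tʲ S_j⁻`. The first form
bounds the exponents of `x` from below, the second from above, so `g` is a Laurent polynomial. Its
coefficients lie in `ℚ_A` by Hermite interpolation modulo `A₁ʲ` (`coeff_mem_of_congruent`): modulo
`A₁ʲ` it agrees with `f_j⁺/√Δ`, whose expansion at each root `α` of `A₁` is over `ℚ_A` because `α`
and `√Δ(α)` were adjoined; in high degree it agrees with `f_j⁻ √(DΔ̄)`. Dividing by `Tʲ` then puts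
the coefficients of `S_j` in `ℚ_A`.

Finiteness of `ℚ_A` rests on `Δ` and `Δ̄` being polynomials in `x` and `x̄`, and on `Δ`, normalized
at `x = 0`, being a factor of a polynomial over `ℚ(t)` (`isIntegral_coeff_of_mul`). -/

namespace SlitPlane

noncomputable section

open scoped LaurentPolynomial Polynomial

/-! ### Power series in `t` with Laurent polynomial coefficients -/

section LaurentSeriesRing

variable {F : Type*} [Field F]

theorem toLaurent_coeff_natCast (p : F[X]) (n : ℕ) :
    (Polynomial.toLaurent p).coeff (n : ℤ) = p.coeff n := by
  rw [LaurentPolynomial.coeff_toLaurent]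
  exact Finsupp.mapDomain_apply Nat.castEmbedding.injective _ n

theorem toLaurent_coeff_of_neg (p : F[X]) {i : ℤ} (hi : i < 0) :
    (Polynomial.toLaurent p).coeff i = 0 := by
  rw [LaurentPolynomial.coeff_toLaurent]
  refine Finsupp.mapDomain_of_notMem_range _ _ ?_
  rintro ⟨n, rfl⟩
  exact absurd hi (by simp)

theorem trunc_coeff (f : F[T;T⁻¹]) (n : ℕ) :
    (LaurentPolynomial.trunc f).coeff n = f.coeff n := by
  induction f using LaurentPolynomial.induction_on' with
  | add p q hp hq => simp [hp, hq]
  | C_mul_T m a =>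
    rw [LaurentPolynomial.trunc_C_mul_T, ← LaurentPolynomial.single_eq_C_mul_T,
      AddMonoidAlgebra.coeff_single, Finsupp.single_apply]
    by_cases h : 0 ≤ m
    · lift m to ℕ using h
      simp [Polynomial.coeff_monomial]
    · rw [if_neg h, if_neg (by omega)]
      simp

theorem toLaurent_trunc {f : F[T;T⁻¹]} (hf : ∀ i < 0, f.coeff i = 0) :
    Polynomial.toLaurent (LaurentPolynomial.trunc f) = f := by
  ext i
  rcases lt_or_ge i 0 with hi | hi
  · rw [toLaurent_coeff_of_neg _ hi, hf i hi]
  · lift i to ℕ using hi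
    rw [toLaurent_coeff_natCast, trunc_coeff]

theorem T_mul_coeff (f : F[T;T⁻¹]) (l i : ℤ) :
    (LaurentPolynomial.T l * f).coeff i = f.coeff (i - l) := by
  induction f using LaurentPolynomial.induction_on' with
  | add p q hp hq => rw [mul_add, AddMonoidAlgebra.coeff_add, AddMonoidAlgebra.coeff_add,
      Finsupp.add_apply, Finsupp.add_apply, hp, hq]
  | C_mul_T m a =>
    rw [mul_left_comm, ← LaurentPolynomial.T_add, ← LaurentPolynomial.single_eq_C_mul_T,
      ← LaurentPolynomial.single_eq_C_mul_T, AddMonoidAlgebra.coeff_single,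
      AddMonoidAlgebra.coeff_single, Finsupp.single_apply, Finsupp.single_apply]
    congr 1
    apply propext
    omega

theorem C_mul_coeff (f : F[T;T⁻¹]) (c : F) (i : ℤ) :
    (LaurentPolynomial.C c * f).coeff i = c * f.coeff i := by
  rw [← LaurentPolynomial.smul_eq_C_mul]
  simp

/-- Series in `t` with coefficients in `F[x]`, seen as series with Laurent polynomial
coefficients. -/
def posEmb : PowerSeries F[X] →+* PowerSeries F[T;T⁻¹] := PowerSeries.map Polynomial.toLaurent

/-- The substitution `x ↦ x⁻¹`. -/
def swapX : PowerSeries F[T;T⁻¹] →+* PowerSeries F[T;T⁻¹] :=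
  PowerSeries.map ((LaurentPolynomial.invert (R := F) : F[T;T⁻¹] ≃ₐ[F] F[T;T⁻¹]) :
    F[T;T⁻¹] →+* F[T;T⁻¹])

/-- Series in `t` with coefficients in `F[x⁻¹]`, seen as series with Laurent polynomial
coefficients. -/
def negEmb : PowerSeries F[X] →+* PowerSeries F[T;T⁻¹] := swapX.comp posEmb

/-- Series in `t`, seen as series with Laurent polynomial coefficients. -/
def constEmb : PowerSeries F →+* PowerSeries F[T;T⁻¹] := PowerSeries.map LaurentPolynomial.C

/-- The monomial `xⁱ`. -/
def monomialX (i : ℤ) : PowerSeries F[T;T⁻¹] := PowerSeries.C (LaurentPolynomial.T i)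

/-- The coefficient of `xⁱ`, a series in `t`. -/
def laurentCoeff (i : ℤ) : PowerSeries F[T;T⁻¹] →+ PowerSeries F where
  toFun f := PowerSeries.mk fun n => (PowerSeries.coeff n f).coeff i
  map_zero' := by ext; simp
  map_add' f g := by ext; simp

theorem coeff_laurentCoeff (i : ℤ) (n : ℕ) (f : PowerSeries F[T;T⁻¹]) :
    PowerSeries.coeff n (laurentCoeff i f) = (PowerSeries.coeff n f).coeff i := by
  simp [laurentCoeff]

theorem ext_laurentCoeff {f g : PowerSeries F[T;T⁻¹]}
    (h : ∀ i, laurentCoeff i f = laurentCoeff i g) : f = g := by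
  ext n i
  rw [← coeff_laurentCoeff, h, coeff_laurentCoeff]

theorem laurentCoeff_constEmb_mul (i : ℤ) (c : PowerSeries F) (f : PowerSeries F[T;T⁻¹]) :
    laurentCoeff i (constEmb c * f) = c * laurentCoeff i f := by
  ext n
  rw [coeff_laurentCoeff, PowerSeries.coeff_mul, PowerSeries.coeff_mul,
    AddMonoidAlgebra.coeff_sum, Finset.sum_apply']
  refine Finset.sum_congr rfl fun p _ => ?_
  rw [constEmb, PowerSeries.coeff_map, C_mul_coeff, coeff_laurentCoeff]

theorem laurentCoeff_monomialX_mul (i l : ℤ) (f : PowerSeries F[T;T⁻¹]) :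
    laurentCoeff i (monomialX l * f) = laurentCoeff (i - l) f := by
  ext n
  rw [coeff_laurentCoeff, monomialX, PowerSeries.coeff_C_mul, T_mul_coeff, coeff_laurentCoeff]

theorem laurentCoeff_swapX (i : ℤ) (f : PowerSeries F[T;T⁻¹]) :
    laurentCoeff i (swapX f) = laurentCoeff (-i) f := by
  ext n
  rw [coeff_laurentCoeff, coeff_laurentCoeff, swapX, PowerSeries.coeff_map]
  exact LaurentPolynomial.invert_apply _ _

@[simp]
theorem swapX_swapX (f : PowerSeries F[T;T⁻¹]) : swapX (swapX f) = f :=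
  ext_laurentCoeff fun i => by simp [laurentCoeff_swapX]

theorem swapX_posEmb (p : PowerSeries F[X]) : swapX (posEmb p) = negEmb p := rfl

@[simp]
theorem swapX_negEmb (p : PowerSeries F[X]) : swapX (negEmb p) = posEmb p :=
  swapX_swapX _

@[simp]
theorem swapX_monomialX (i : ℤ) : swapX (monomialX i : PowerSeries F[T;T⁻¹]) = monomialX (-i) := by
  rw [monomialX, swapX, PowerSeries.map_C]
  simp [monomialX]

@[simp]
theorem swapX_constEmb (c : PowerSeries F) :
    swapX (constEmb c : PowerSeries F[T;T⁻¹]) = constEmb c := by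
  ext n : 1
  simp [swapX, constEmb]

@[simp]
theorem swapX_X : swapX (PowerSeries.X : PowerSeries F[T;T⁻¹]) = PowerSeries.X := by
  simp [swapX]

theorem monomialX_add (i l : ℤ) :
    (monomialX (i + l) : PowerSeries F[T;T⁻¹]) = monomialX i * monomialX l := by
  rw [monomialX, LaurentPolynomial.T_add, map_mul]
  rfl

@[simp]
theorem monomialX_zero : (monomialX 0 : PowerSeries F[T;T⁻¹]) = 1 := by
  simp [monomialX]

theorem monomialX_neg_mul (i : ℤ) :
    (monomialX (-i) * monomialX i : PowerSeries F[T;T⁻¹]) = 1 := by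
  rw [← monomialX_add, neg_add_cancel, monomialX_zero]

theorem monomialX_natCast (n : ℕ) :
    (monomialX n : PowerSeries F[T;T⁻¹]) = posEmb (PowerSeries.C (Polynomial.X ^ n)) := by
  rw [posEmb, PowerSeries.map_C, Polynomial.toLaurent_X_pow, monomialX]

theorem monomialX_pow (i : ℤ) (n : ℕ) :
    (monomialX i ^ n : PowerSeries F[T;T⁻¹]) = monomialX (n * i) := by
  rw [monomialX, ← map_pow, LaurentPolynomial.T_pow, monomialX]

theorem constEmb_eq_posEmb (c : PowerSeries F) :
    constEmb c = posEmb (PowerSeries.map Polynomial.C c) := by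
  ext n : 1
  simp [constEmb, posEmb]

theorem posEmb_injective : Function.Injective (posEmb (F := F)) :=
  PowerSeries.map_injective _ Polynomial.toLaurent_injective

theorem swapX_injective : Function.Injective (swapX (F := F)) :=
  Function.LeftInverse.injective (g := swapX) swapX_swapX

theorem negEmb_injective : Function.Injective (negEmb (F := F)) :=
  swapX_injective.comp posEmb_injective

theorem laurentCoeff_posEmb_natCast (p : PowerSeries F[X]) (i : ℕ) :
    laurentCoeff i (posEmb p) = PowerSeries.mk fun n => (PowerSeries.coeff n p).coeff i := by
  ext n
  rw [coeff_laurentCoeff, posEmb, PowerSeries.coeff_map, toLaurent_coeff_natCast,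
    PowerSeries.coeff_mk]

theorem laurentCoeff_posEmb_of_neg (p : PowerSeries F[X]) {i : ℤ} (hi : i < 0) :
    laurentCoeff i (posEmb p) = 0 := by
  ext n
  rw [coeff_laurentCoeff, posEmb, PowerSeries.coeff_map, toLaurent_coeff_of_neg _ hi, map_zero]

theorem laurentCoeff_negEmb_of_pos (p : PowerSeries F[X]) {i : ℤ} (hi : 0 < i) :
    laurentCoeff i (negEmb p) = 0 := by
  rw [← swapX_posEmb, laurentCoeff_swapX, laurentCoeff_posEmb_of_neg _ (by omega)]

theorem laurentCoeff_constEmb (c : PowerSeries F) (i : ℤ) :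
    laurentCoeff i (constEmb c) = if i = 0 then c else 0 := by
  ext n
  rw [coeff_laurentCoeff, constEmb, PowerSeries.coeff_map, LaurentPolynomial.C_apply]
  split_ifs <;> simp

theorem laurentCoeff_zero_posEmb (p : PowerSeries F[X]) :
    laurentCoeff 0 (posEmb p) = PowerSeries.map (Polynomial.evalRingHom 0) p := by
  ext n
  have := laurentCoeff_posEmb_natCast p 0
  rw [Nat.cast_zero] at this
  rw [this]
  simp [Polynomial.coeff_zero_eq_eval_zero]

theorem exists_posEmb_eq {f : PowerSeries F[T;T⁻¹]} (hf : ∀ i < 0, laurentCoeff i f = 0) :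
    ∃ p, posEmb p = f := by
  refine ⟨PowerSeries.mk fun n => LaurentPolynomial.trunc (PowerSeries.coeff n f), ?_⟩
  ext n : 1
  rw [posEmb, PowerSeries.coeff_map, PowerSeries.coeff_mk]
  refine toLaurent_trunc fun i hi => ?_
  rw [← coeff_laurentCoeff, hf i hi, map_zero]

theorem exists_negEmb_eq {f : PowerSeries F[T;T⁻¹]} (hf : ∀ i > 0, laurentCoeff i f = 0) :
    ∃ p, negEmb p = f := by
  obtain ⟨p, hp⟩ := exists_posEmb_eq (f := swapX f) fun i hi => by
    rw [laurentCoeff_swapX, hf _ (by omega)]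
  exact ⟨p, by rw [← swapX_posEmb, hp, swapX_swapX]⟩

/-- A series whose exponents of `x` are both nonnegative and nonpositive does not depend on `x`. -/
theorem posEmb_eq_negEmb {p q : PowerSeries F[X]} (h : posEmb p = negEmb q) :
    posEmb p = constEmb (PowerSeries.map (Polynomial.evalRingHom 0) p) := by
  refine ext_laurentCoeff fun i => ?_
  rw [laurentCoeff_constEmb]
  rcases lt_trichotomy i 0 with hi | rfl | hi
  · rw [laurentCoeff_posEmb_of_neg _ hi, if_neg hi.ne]
  · rw [if_pos rfl, laurentCoeff_zero_posEmb]
  · rw [if_neg hi.ne', h, laurentCoeff_negEmb_of_pos _ hi]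

theorem constantCoeff_posEmb (p : PowerSeries F[X]) :
    PowerSeries.constantCoeff (posEmb p) =
      Polynomial.toLaurent (PowerSeries.constantCoeff p) := by
  rw [← PowerSeries.coeff_zero_eq_constantCoeff_apply,
    ← PowerSeries.coeff_zero_eq_constantCoeff_apply, posEmb, PowerSeries.coeff_map]

theorem constantCoeff_swapX (f : PowerSeries F[T;T⁻¹]) :
    PowerSeries.constantCoeff (swapX f) =
      LaurentPolynomial.invert (PowerSeries.constantCoeff f) := by
  rw [← PowerSeries.coeff_zero_eq_constantCoeff_apply,
    ← PowerSeries.coeff_zero_eq_constantCoeff_apply, swapX, PowerSeries.coeff_map]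
  rfl

theorem isUnit_of_constantCoeff_one {R : Type*} [CommRing R] {f : PowerSeries R}
    (h : PowerSeries.constantCoeff f = 1) : IsUnit f := by
  rw [PowerSeries.isUnit_iff_constantCoeff, h]
  exact isUnit_one

end LaurentSeriesRing

/-! ### Existence and uniqueness of the canonical factorization -/

section Factorization

variable {F : Type*} [Field F]

/-- The part of a Laurent polynomial formed by its terms of positive degree. -/
def positivePart (f : F[T;T⁻¹]) : F[X] :=
  LaurentPolynomial.trunc f - Polynomial.C (f.coeff 0)

theorem positivePart_coeff_zero (f : F[T;T⁻¹]) : (positivePart f).coeff 0 = 0 := by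
  simp [positivePart, trunc_coeff]

theorem positivePart_coeff (f : F[T;T⁻¹]) {n : ℕ} (hn : n ≠ 0) :
    (positivePart f).coeff n = f.coeff n := by
  simp [positivePart, trunc_coeff, Polynomial.coeff_C, hn]

/-- The coefficients of the series `V` with polynomial coefficients in `x`, such that `V - 1` has
no constant term in `x` and `V E` has no terms of positive degree in `x`. -/
def factorCoeff (E : PowerSeries F[T;T⁻¹]) : ℕ → F[X]
  | 0 => 1
  | n + 1 => -positivePart (∑ k : Fin (n + 1),
      Polynomial.toLaurent (factorCoeff E k) * PowerSeries.coeff (n + 1 - k) E)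
decreasing_by exact k.2

/-- As `E` is `1` at `t = 0`, the coefficient of `t^(n+1)` in `V E` is that of `V` plus terms
already known, so it can be chosen to cancel their positive part. The series `V` plays the role of
`1/Δ`. -/
theorem exists_mul_eq_negEmb {E : PowerSeries F[T;T⁻¹]} (hE : PowerSeries.constantCoeff E = 1) :
    ∃ V Q : PowerSeries F[X], posEmb V * E = negEmb Q ∧ PowerSeries.constantCoeff V = 1 ∧
      PowerSeries.map (Polynomial.evalRingHom 0) V = 1 := by
  set V : PowerSeries F[X] := PowerSeries.mk (factorCoeff E) with hV
  have h0 : factorCoeff E 0 = 1 := by rw [factorCoeff]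
  have hs : ∀ n, factorCoeff E (n + 1) = -positivePart (∑ k : Fin (n + 1),
      Polynomial.toLaurent (factorCoeff E k) * PowerSeries.coeff (n + 1 - k) E) := fun n => by
    rw [factorCoeff]
  obtain ⟨Q, hQ⟩ := exists_negEmb_eq (f := posEmb V * E) fun i hi => by
    ext n
    rw [coeff_laurentCoeff, map_zero]
    rcases n with _ | n
    · rw [PowerSeries.coeff_zero_eq_constantCoeff_apply, map_mul, hE, constantCoeff_posEmb,
        ← PowerSeries.coeff_zero_eq_constantCoeff_apply, hV, PowerSeries.coeff_mk, h0]
      simp only [map_one, mul_one]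
      rw [← LaurentPolynomial.T_zero, LaurentPolynomial.T_apply, if_neg (by omega)]
    · rw [PowerSeries.coeff_mul, Finset.Nat.sum_antidiagonal_eq_sum_range_succ_mk,
        Finset.sum_range_succ, Nat.sub_self, PowerSeries.coeff_zero_eq_constantCoeff_apply, hE,
        mul_one, posEmb, Finset.sum_range]
      simp only [PowerSeries.coeff_map, hV, PowerSeries.coeff_mk]
      rw [hs]
      lift i to ℕ using hi.le
      rw [AddMonoidAlgebra.coeff_add, Finsupp.add_apply, toLaurent_coeff_natCast,
        Polynomial.coeff_neg, positivePart_coeff _ (by omega), add_neg_cancel]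
  refine ⟨V, Q, hQ.symm, ?_, ?_⟩
  · rw [← PowerSeries.coeff_zero_eq_constantCoeff_apply, hV, PowerSeries.coeff_mk, h0]
  · ext n
    rw [PowerSeries.coeff_map, hV, PowerSeries.coeff_mk, Polynomial.coe_evalRingHom,
      ← Polynomial.coeff_zero_eq_eval_zero, PowerSeries.coeff_one]
    rcases n with _ | n
    · rw [h0, Polynomial.coeff_one_zero, if_pos rfl]
    · rw [hs, Polynomial.coeff_neg, positivePart_coeff_zero, neg_zero, if_neg (by omega)]

theorem constantCoeff_map_one {R S : Type*} [CommRing R] [CommRing S] (φ : R →+* S)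
    {f : PowerSeries R} (h : PowerSeries.constantCoeff f = 1) :
    PowerSeries.constantCoeff (PowerSeries.map φ f) = 1 := by
  rw [← PowerSeries.coeff_zero_eq_constantCoeff_apply, PowerSeries.coeff_map,
    PowerSeries.coeff_zero_eq_constantCoeff_apply, h, map_one]

theorem map_evalRingHom_map_C (c : PowerSeries F) :
    PowerSeries.map (Polynomial.evalRingHom 0) (PowerSeries.map Polynomial.C c) = c := by
  ext n
  simp

theorem constEmb_eq_negEmb (c : PowerSeries F) :
    constEmb c = negEmb (PowerSeries.map Polynomial.C c) := by
  rw [← swapX_posEmb, ← constEmb_eq_posEmb, swapX_constEmb]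

theorem negEmb_constantCoeff_one {Q : PowerSeries F[X]}
    (h : PowerSeries.constantCoeff (negEmb Q) = 1) : PowerSeries.constantCoeff Q = 1 := by
  rw [← swapX_posEmb, constantCoeff_swapX, constantCoeff_posEmb] at h
  have h' := congrArg LaurentPolynomial.invert h
  rw [LaurentPolynomial.involutive_invert, map_one] at h'
  exact Polynomial.toLaurent_injective (h'.trans (map_one _).symm)

/-- Take `Δ = 1/V`. The remaining series `Q(x̄)` is normalized by extracting its value at `x̄ = 0`,
which is `D`. -/
theorem exists_canonical_factors {E : PowerSeries F[T;T⁻¹]}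
    (hE : PowerSeries.constantCoeff E = 1) :
    ∃ (D : PowerSeries F) (P Q : PowerSeries F[X]), E = constEmb D * posEmb P * negEmb Q ∧
      PowerSeries.constantCoeff D = 1 ∧
      PowerSeries.map (Polynomial.evalRingHom 0) P = 1 ∧
      PowerSeries.map (Polynomial.evalRingHom 0) Q = 1 ∧
      PowerSeries.constantCoeff P = 1 ∧ PowerSeries.constantCoeff Q = 1 := by
  obtain ⟨V, Q, hVQ, hV, hV'⟩ := exists_mul_eq_negEmb hE
  obtain ⟨P, hP⟩ := (isUnit_of_constantCoeff_one hV).exists_right_inv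
  have hQ : PowerSeries.constantCoeff Q = 1 := negEmb_constantCoeff_one <| by
    rw [← hVQ, map_mul, hE, constantCoeff_posEmb, hV, map_one, mul_one]
  set D := PowerSeries.map (Polynomial.evalRingHom 0) Q with hDdef
  have hD : PowerSeries.constantCoeff D = 1 := constantCoeff_map_one _ hQ
  obtain ⟨D', hD'⟩ := (isUnit_of_constantCoeff_one hD).exists_right_inv
  have hcP := congrArg PowerSeries.constantCoeff hP
  rw [map_mul, hV, one_mul, map_one] at hcP
  have heP := congrArg (PowerSeries.map (Polynomial.evalRingHom (0 : F))) hP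
  rw [map_mul, hV', one_mul, map_one] at heP
  have hcD := congrArg PowerSeries.constantCoeff hD'
  rw [map_mul, hD, one_mul, map_one] at hcD
  refine ⟨D, P, PowerSeries.map Polynomial.C D' * Q, ?_, hD, heP, ?_, hcP, ?_⟩
  · rw [map_mul, ← constEmb_eq_negEmb, ← hVQ]
    have h1 : constEmb D * constEmb D' = 1 := by rw [← map_mul, hD', map_one]
    have h2 : posEmb V * posEmb P = 1 := by rw [← map_mul, hP, map_one]
    linear_combination (-E) * h1 * (posEmb V * posEmb P) - E * h2
  · rw [map_mul, map_evalRingHom_map_C, mul_comm, hD']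
  · rw [map_mul, hQ, mul_one]
    exact constantCoeff_map_one _ hcD

/-- The quotient `P/P'` has nonnegative exponents of `x` and equals `D'Q'/(DQ)`, with nonpositive
ones; it is therefore free of `x`, hence equal to `1`. After cancelling `P`, the value at `x̄ = 0`
separates `D` from `Q`. -/
theorem canonical_factors_unique {D D' : PowerSeries F} {P P' Q Q' : PowerSeries F[X]}
    (h : constEmb D * posEmb P * negEmb Q = constEmb D' * posEmb P' * negEmb Q')
    (hD : PowerSeries.constantCoeff D = 1)
    (hP : PowerSeries.map (Polynomial.evalRingHom 0) P = 1)
    (hQ : PowerSeries.map (Polynomial.evalRingHom 0) Q = 1)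
    (hP' : PowerSeries.map (Polynomial.evalRingHom 0) P' = 1)
    (hQ' : PowerSeries.map (Polynomial.evalRingHom 0) Q' = 1)
    (hPt' : PowerSeries.constantCoeff P' = 1)
    (hQt : PowerSeries.constantCoeff Q = 1) :
    D = D' ∧ P = P' ∧ Q = Q' := by
  obtain ⟨U, hU⟩ := (isUnit_of_constantCoeff_one hPt').exists_right_inv
  obtain ⟨W, hW⟩ := (isUnit_of_constantCoeff_one hQt).exists_right_inv
  obtain ⟨C, hC⟩ := (isUnit_of_constantCoeff_one hD).exists_right_inv
  have hU1 : posEmb P' * posEmb U = 1 := by rw [← map_mul, hU, map_one]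
  have hW1 : negEmb Q * negEmb W = 1 := by rw [← map_mul, hW, map_one]
  have hC1 : constEmb D * constEmb C = 1 := by rw [← map_mul, hC, map_one]
  have key : posEmb (P * U) = negEmb (PowerSeries.map Polynomial.C (C * D') * (Q' * W)) := by
    simp only [map_mul, ← constEmb_eq_negEmb]
    linear_combination (constEmb C * negEmb W * posEmb U) * h
      - (posEmb P * posEmb U * negEmb Q * negEmb W) * hC1 - (posEmb P * posEmb U) * hW1
      + (constEmb C * constEmb D' * negEmb Q' * negEmb W) * hU1
  have hUe := congrArg (PowerSeries.map (Polynomial.evalRingHom (0 : F))) hU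
  rw [map_mul, hP', one_mul, map_one] at hUe
  have h1 := posEmb_eq_negEmb key
  rw [map_mul (PowerSeries.map _), hP, hUe, one_mul, map_one, ← map_one posEmb] at h1
  have hPU := posEmb_injective h1
  have hPP : P = P' := by linear_combination P' * hPU - P * hU
  subst hPP
  have h2 : negEmb (PowerSeries.map Polynomial.C D * Q) =
      negEmb (PowerSeries.map Polynomial.C D' * Q') := by
    simp only [map_mul, ← constEmb_eq_negEmb]
    linear_combination posEmb U * h - (constEmb D * negEmb Q - constEmb D' * negEmb Q') * hU1
  have h3 := negEmb_injective h2
  have h4 := congrArg (PowerSeries.map (Polynomial.evalRingHom (0 : F))) h3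
  rw [map_mul, map_mul, hQ, hQ', mul_one, mul_one, map_evalRingHom_map_C,
    map_evalRingHom_map_C] at h4
  subst h4
  refine ⟨rfl, rfl, ?_⟩
  have hu : IsUnit (PowerSeries.map (Polynomial.C (R := F)) D) :=
    isUnit_of_constantCoeff_one (constantCoeff_map_one _ hD)
  exact hu.mul_left_cancel h3

end Factorization

/-! ### Square roots -/

theorem constantCoeff_sqrtSeries {R : Type*} [CommRing R] [Algebra ℚ R] {F : PowerSeries R}
    (h : PowerSeries.constantCoeff F = 1) : PowerSeries.constantCoeff (sqrtSeries F) = 1 := by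
  have hs := hasSubst_sub_one h
  obtain ⟨B, hB⟩ : PowerSeries.X ∣ PowerSeries.binomialSeries R (1 / 2 : ℚ) - 1 := by
    rw [PowerSeries.X_dvd_iff, map_sub, ← PowerSeries.coeff_zero_eq_constantCoeff_apply,
      PowerSeries.binomialSeries_coeff]
    simp
  have h1 : sqrtSeries F = 1 + (F - 1) * B.subst (F - 1) := by
    rw [sqrtSeries, eq_add_of_sub_eq hB, PowerSeries.subst_add hs, PowerSeries.subst_mul hs,
      PowerSeries.subst_X hs, ← PowerSeries.coe_substAlgHom hs, map_one, add_comm]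
  rw [h1]
  simp [h]

/-- In a domain the only other root is the opposite, with constant term `-1`. This identifies square
roots without computing with the binomial series. -/
theorem eq_of_sq_eq_sq_of_constantCoeff {R : Type*} [CommRing R] [IsDomain R] [CharZero R]
    {f g : PowerSeries R} (h : f ^ 2 = g ^ 2) (hf : PowerSeries.constantCoeff f = 1)
    (hg : PowerSeries.constantCoeff g = 1) : f = g := by
  rcases sq_eq_sq_iff_eq_or_eq_neg.mp h with h | h
  · exact h
  · have := congrArg PowerSeries.constantCoeff h
    rw [map_neg, hf, hg] at this
    norm_num at this

theorem map_sqrtSeries {R S : Type*} [CommRing R] [Algebra ℚ R] [CommRing S] [Algebra ℚ S]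
    [IsDomain S] [CharZero S] (φ : R →+* S) {F : PowerSeries R}
    (h : PowerSeries.constantCoeff F = 1) :
    PowerSeries.map φ (sqrtSeries F) = sqrtSeries (PowerSeries.map φ F) := by
  have h' := constantCoeff_map_one φ h
  refine eq_of_sq_eq_sq_of_constantCoeff ?_
    (constantCoeff_map_one φ (constantCoeff_sqrtSeries h)) (constantCoeff_sqrtSeries h')
  rw [← map_pow, sqrtSeries_sq h, sqrtSeries_sq h']

/-! ### The embedding in `ℂ(x)((t))` -/

/-- The inclusion of `ℝ[x,x⁻¹]` in `ℂ(x)`. -/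
def laurentToRatFunc : ℝ[T;T⁻¹] →+* RatFunc ℂ :=
  LaurentPolynomial.eval₂ (RatFunc.C.comp Complex.ofRealHom)
    (Units.mk0 RatFunc.X RatFunc.X_ne_zero)

theorem laurentToRatFunc_toLaurent (p : ℝ[X]) :
    laurentToRatFunc (Polynomial.toLaurent p) =
      Polynomial.eval₂ (RatFunc.C.comp Complex.ofRealHom) RatFunc.X p := by
  rw [laurentToRatFunc, LaurentPolynomial.eval₂_toLaurent]
  rfl

@[simp]
theorem laurentToRatFunc_T (i : ℤ) :
    laurentToRatFunc (LaurentPolynomial.T i) = RatFunc.X ^ i := by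
  simp [laurentToRatFunc]

@[simp]
theorem laurentToRatFunc_C (r : ℝ) :
    laurentToRatFunc (LaurentPolynomial.C r) = RatFunc.C (r : ℂ) := by
  simp [laurentToRatFunc]

theorem laurentToRatFunc_toLaurent_eq (p : ℝ[X]) :
    laurentToRatFunc (Polynomial.toLaurent p) =
      algebraMap ℂ[X] (RatFunc ℂ) (p.map Complex.ofRealHom) := by
  rw [laurentToRatFunc_toLaurent]
  induction p using Polynomial.induction_on' with
  | add p q hp hq => simp [hp, hq, Polynomial.eval₂_add]
  | monomial n a => simp [← Polynomial.C_mul_X_pow_eq_monomial]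

theorem laurentToRatFunc_injective : Function.Injective laurentToRatFunc := by
  rw [injective_iff_map_eq_zero]
  intro f hf
  obtain ⟨n, p, hp⟩ := f.exists_T_pow
  have h1 : laurentToRatFunc (Polynomial.toLaurent p) = 0 := by rw [hp, map_mul, hf, zero_mul]
  rw [laurentToRatFunc_toLaurent_eq] at h1
  have h2 : p = 0 := by
    have h3 := (map_eq_zero_iff _ (IsFractionRing.injective ℂ[X] (RatFunc ℂ))).mp h1
    exact (Polynomial.map_eq_zero_iff Complex.ofRealHom.injective).mp h3
  rw [h2, map_zero] at hp
  exact (LaurentPolynomial.isUnit_T (R := ℝ) n).mul_left_eq_zero.mp hp.symm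

theorem laurentToRatFunc_invert (p : ℝ[X]) :
    laurentToRatFunc (LaurentPolynomial.invert (Polynomial.toLaurent p)) =
      Polynomial.eval₂ (RatFunc.C.comp Complex.ofRealHom) (RatFunc.X)⁻¹ p := by
  induction p using Polynomial.induction_on' with
  | add p q hp hq => simp only [map_add, hp, hq, Polynomial.eval₂_add]
  | monomial n a => simp [Polynomial.eval₂_monomial]

/-- The inclusion of `ℝ[x,x⁻¹][[t]]` in `ℂ(x)((t))`. -/
def toSeriesXT : PowerSeries ℝ[T;T⁻¹] →+* SeriesXT :=
  (HahnSeries.ofPowerSeries ℤ (RatFunc ℂ)).comp (PowerSeries.map laurentToRatFunc)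

/-- Identities in `ℂ(x)((t))`, where exponents of `x` have no meaning, can thus be proved in
`ℝ[x,x⁻¹][[t]]`, where they do. -/
theorem toSeriesXT_injective : Function.Injective toSeriesXT := by
  intro f g h
  have h' : HahnSeries.ofPowerSeries ℤ (RatFunc ℂ) (PowerSeries.map laurentToRatFunc f) =
    HahnSeries.ofPowerSeries ℤ (RatFunc ℂ) (PowerSeries.map laurentToRatFunc g) := h
  exact PowerSeries.map_injective _ laurentToRatFunc_injective
    (HahnSeries.ofPowerSeries_injective h')

theorem toSeriesXT_posEmb (p : PowerSeries ℝ[X]) :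
    toSeriesXT (posEmb p) = substX RatFunc.X p := by
  rw [toSeriesXT, substX, RingHom.comp_apply]
  congr 1
  ext n : 1
  simp only [posEmb, PowerSeries.coeff_map, laurentToRatFunc_toLaurent]
  rfl

theorem toSeriesXT_negEmb (p : PowerSeries ℝ[X]) :
    toSeriesXT (negEmb p) = substX (RatFunc.X)⁻¹ p := by
  rw [toSeriesXT, substX, RingHom.comp_apply]
  congr 1
  ext n : 1
  rw [PowerSeries.coeff_map, PowerSeries.coeff_map, ← swapX_posEmb, swapX, PowerSeries.coeff_map,
    posEmb, PowerSeries.coeff_map]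
  exact laurentToRatFunc_invert _

@[simp]
theorem toSeriesXT_X : toSeriesXT PowerSeries.X = t := by
  rw [toSeriesXT, RingHom.comp_apply, PowerSeries.map_X, HahnSeries.ofPowerSeries_X, t]

theorem x_zpow (i : ℤ) : x ^ i = HahnSeries.C (RatFunc.X ^ i) :=
  (map_zpow₀ (HahnSeries.C : RatFunc ℂ →+* SeriesXT) _ _).symm

@[simp]
theorem toSeriesXT_monomialX (i : ℤ) : toSeriesXT (monomialX i) = x ^ i := by
  rw [toSeriesXT, RingHom.comp_apply, monomialX, PowerSeries.map_C, HahnSeries.ofPowerSeries_C,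
    laurentToRatFunc_T, x_zpow]

theorem toSeriesXT_constEmb (c : PowerSeries ℝ) :
    toSeriesXT (constEmb c) = inclT (ofRealSeries c) := by
  rw [toSeriesXT, RingHom.comp_apply, inclT, ofRealSeries]
  ext n
  rw [HahnSeries.map_coeff]
  rcases lt_or_ge n 0 with hn | hn
  · rw [PowerSeries.coeff_coe, PowerSeries.coeff_coe]
    simp [hn]
  · lift n to ℕ using hn
    rw [LaurentSeries.coeff_coe_powerSeries, LaurentSeries.coeff_coe_powerSeries]
    simp [constEmb]

theorem constantCoeff_negEmb_one {Q : PowerSeries ℝ[X]}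
    (h : PowerSeries.constantCoeff Q = 1) : PowerSeries.constantCoeff (negEmb Q) = 1 := by
  rw [← swapX_posEmb, constantCoeff_swapX, constantCoeff_posEmb, h, map_one, map_one]

theorem constantCoeff_posEmb_one {Q : PowerSeries ℝ[X]}
    (h : PowerSeries.constantCoeff Q = 1) : PowerSeries.constantCoeff (posEmb Q) = 1 := by
  rw [constantCoeff_posEmb, h, map_one]

/-! ### The Laurent polynomials attached to the step set -/

/-- The Laurent polynomial `∑_{(i,h) ∈ A} xⁱ`. -/
def stepPoly (A : Finset (ℤ × ℤ)) (h : ℤ) : ℝ[T;T⁻¹] :=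
  ∑ s ∈ A with s.2 = h, LaurentPolynomial.T s.1

/-- `1 - t A₀`. -/
def levelKernel (A : Finset (ℤ × ℤ)) : PowerSeries ℝ[T;T⁻¹] :=
  1 - PowerSeries.X * PowerSeries.C (stepPoly A 0)

/-- `2 t A₁`. -/
def twoTA₁ (A : Finset (ℤ × ℤ)) : PowerSeries ℝ[T;T⁻¹] :=
  2 * PowerSeries.X * PowerSeries.C (stepPoly A 1)

/-- `δ`, as a series with Laurent polynomial coefficients. -/
def deltaSeries (A : Finset (ℤ × ℤ)) : PowerSeries ℝ[T;T⁻¹] :=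
  (levelKernel A - twoTA₁ A) * (levelKernel A + twoTA₁ A)

theorem toSeriesXT_C_stepPoly (A : Finset (ℤ × ℤ)) (h : ℤ) :
    toSeriesXT (PowerSeries.C (stepPoly A h)) = ∑ s ∈ A with s.2 = h, x ^ s.1 := by
  simp only [stepPoly, map_sum]
  exact Finset.sum_congr rfl fun s _ => toSeriesXT_monomialX s.1

theorem toSeriesXT_levelKernel (A : Finset (ℤ × ℤ)) :
    toSeriesXT (levelKernel A) = 1 - t * A₀ A := by
  simp [levelKernel, toSeriesXT_C_stepPoly, A₀]

theorem toSeriesXT_twoTA₁ (A : Finset (ℤ × ℤ)) :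
    toSeriesXT (twoTA₁ A) = 2 * t * A₁ A := by
  have h2 : toSeriesXT 2 = 2 := map_ofNat _ 2
  simp [twoTA₁, toSeriesXT_C_stepPoly, A₁, h2]

theorem toSeriesXT_deltaSeries (A : Finset (ℤ × ℤ)) :
    toSeriesXT (deltaSeries A) = delta A := by
  rw [deltaSeries, map_mul, map_sub, map_add, toSeriesXT_levelKernel, toSeriesXT_twoTA₁, delta]

theorem constantCoeff_deltaSeries (A : Finset (ℤ × ℤ)) :
    PowerSeries.constantCoeff (deltaSeries A) = 1 := by
  simp [deltaSeries, levelKernel, twoTA₁]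

theorem factor_iff (A : Finset (ℤ × ℤ)) (F : Triple) :
    delta A = inclT (ofRealSeries F.D) * substX RatFunc.X F.Delta *
        substX (RatFunc.X)⁻¹ F.DeltaBar ↔
      deltaSeries A = constEmb F.D * posEmb F.Delta * negEmb F.DeltaBar := by
  rw [← toSeriesXT_injective.eq_iff, map_mul, map_mul, toSeriesXT_deltaSeries, toSeriesXT_constEmb,
    toSeriesXT_posEmb, toSeriesXT_negEmb]

theorem existsUnique_canonicalFactorization (A : Finset (ℤ × ℤ)) :
    ∃! F : Triple, IsCanonicalFactorization A F := by
  obtain ⟨D, P, Q, h, h1, h2, h3, h4, h5⟩ := exists_canonical_factors (constantCoeff_deltaSeries A)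
  refine ⟨⟨D, P, Q⟩, ⟨(factor_iff A ⟨D, P, Q⟩).mpr h, h1, h2, h3, h4, h5⟩, ?_⟩
  rintro ⟨D', P', Q'⟩ ⟨h', h1', h2', h3', h4', h5'⟩
  rw [factor_iff, h] at h'
  obtain ⟨rfl, rfl, rfl⟩ := canonical_factors_unique h' h1 h2 h3 h2' h3' h4' h5
  rfl

/-- The power series `√Δ(x;t)`. -/
def rootPos (F : Triple) : PowerSeries ℝ[X] := sqrtSeries F.Delta

/-- The power series `√(D(t)Δ̄(z;t))`. -/
def rootNeg (F : Triple) : PowerSeries ℝ[X] :=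
  sqrtSeries (PowerSeries.map Polynomial.C F.D * F.DeltaBar)

/-! ### Square roots of the canonical factors -/

section

variable {A : Finset (ℤ × ℤ)} {F : Triple}

theorem IsCanonicalFactorization.deltaSeries_eq (hF : IsCanonicalFactorization A F) :
    deltaSeries A = constEmb F.D * posEmb F.Delta * negEmb F.DeltaBar :=
  (factor_iff A F).mp hF.factor

theorem IsCanonicalFactorization.constantCoeff_mul (hF : IsCanonicalFactorization A F) :
    PowerSeries.constantCoeff (PowerSeries.map Polynomial.C F.D * F.DeltaBar) = 1 := by
  rw [map_mul, constantCoeff_map_one _ hF.D_zero, hF.DeltaBar_t_zero, mul_one]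

theorem IsCanonicalFactorization.rootPos_sq (hF : IsCanonicalFactorization A F) :
    rootPos F ^ 2 = F.Delta :=
  sqrtSeries_sq hF.Delta_t_zero

theorem IsCanonicalFactorization.rootNeg_sq (hF : IsCanonicalFactorization A F) :
    rootNeg F ^ 2 = PowerSeries.map Polynomial.C F.D * F.DeltaBar :=
  sqrtSeries_sq hF.constantCoeff_mul

theorem IsCanonicalFactorization.constantCoeff_rootPos (hF : IsCanonicalFactorization A F) :
    PowerSeries.constantCoeff (rootPos F) = 1 :=
  constantCoeff_sqrtSeries hF.Delta_t_zero

theorem IsCanonicalFactorization.constantCoeff_rootNeg (hF : IsCanonicalFactorization A F) :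
    PowerSeries.constantCoeff (rootNeg F) = 1 :=
  constantCoeff_sqrtSeries hF.constantCoeff_mul

theorem IsCanonicalFactorization.sq_eq_deltaSeries (hF : IsCanonicalFactorization A F) :
    (posEmb (rootPos F) * negEmb (rootNeg F)) ^ 2 = deltaSeries A := by
  rw [mul_pow, ← map_pow, ← map_pow, hF.rootPos_sq, hF.rootNeg_sq, map_mul, ← constEmb_eq_negEmb,
    hF.deltaSeries_eq]
  ring

theorem IsCanonicalFactorization.rootPos_x_zero (hF : IsCanonicalFactorization A F) :
    PowerSeries.map (Polynomial.evalRingHom 0) (rootPos F) = 1 := by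
  refine eq_of_sq_eq_sq_of_constantCoeff ?_ (constantCoeff_map_one _ hF.constantCoeff_rootPos)
    (map_one _)
  rw [← map_pow, hF.rootPos_sq, hF.Delta_x_zero, one_pow]

theorem IsCanonicalFactorization.rootNeg_x_zero (hF : IsCanonicalFactorization A F) :
    PowerSeries.map (Polynomial.evalRingHom 0) (rootNeg F) = sqrtSeries F.D := by
  refine eq_of_sq_eq_sq_of_constantCoeff ?_ (constantCoeff_map_one _ hF.constantCoeff_rootNeg)
    (constantCoeff_sqrtSeries hF.D_zero)
  rw [← map_pow, hF.rootNeg_sq, map_mul, hF.DeltaBar_x_zero, mul_one, map_evalRingHom_map_C,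
    sqrtSeries_sq hF.D_zero]

end

/-! ### Recurrence for the numbers of walks -/

section Recurrence

variable (A : Finset (ℤ × ℤ))

theorem count_zero (i j : ℤ) : count A i j 0 = if i = 0 ∧ j = 0 then 1 else 0 := by
  rw [count]
  split_ifs with h
  · obtain ⟨rfl, rfl⟩ := h
    rw [Set.ncard_eq_one]
    refine ⟨fun _ => (0, 0), Set.eq_singleton_iff_unique_mem.mpr ⟨?_, ?_⟩⟩
    · exact ⟨rfl, rfl, fun k => k.elim0, fun k => k.elim0⟩
    · rintro w ⟨hw, -⟩
      funext k
      rw [Fin.fin_one_eq_zero k, hw]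
  · rw [Set.ncard_eq_zero (slitWalks_finite A i j 0), Set.eq_empty_iff_forall_notMem]
    rintro w ⟨hw, hw', -⟩
    have h0 : w 0 = (i, j) := hw'
    rw [hw, Prod.mk.injEq] at h0
    exact h ⟨h0.1.symm, h0.2.symm⟩

theorem snoc_mem_slitWalks {p s : ℤ × ℤ} {n : ℕ} (hs : s ∈ A) (hp : p ∉ halfLine)
    {v : Fin (n + 1) → ℤ × ℤ} (hv : v ∈ slitWalks A (p.1 - s.1) (p.2 - s.2) n) :
    (Fin.snoc v p : Fin (n + 2) → ℤ × ℤ) ∈ slitWalks A p.1 p.2 (n + 1) := by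
  obtain ⟨h0, hl, hA, hH⟩ := hv
  refine ⟨?_, ?_, fun k => ?_, fun k => ?_⟩
  · rw [← Fin.castSucc_zero, Fin.snoc_castSucc, h0]
  · rw [Fin.snoc_last]
  · rw [Fin.snoc_castSucc]
    induction k using Fin.lastCases with
    | last =>
      rw [Fin.succ_last, Fin.snoc_last, hl]
      convert hs using 1
      ext <;> simp
    | cast k =>
      rw [Fin.succ_castSucc, Fin.snoc_castSucc]
      exact hA k
  · induction k using Fin.lastCases with
    | last => rwa [Fin.succ_last, Fin.snoc_last]
    | cast k =>
      rw [Fin.succ_castSucc, Fin.snoc_castSucc]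
      exact hH k

theorem count_succ_of_mem {i j : ℤ} (h : (i, j) ∈ halfLine) (n : ℕ) : count A i j (n + 1) = 0 := by
  rw [count, Set.ncard_eq_zero (slitWalks_finite A i j _), Set.eq_empty_iff_forall_notMem]
  rintro w ⟨-, hl, -, hH⟩
  have := hH (Fin.last n)
  rw [Fin.succ_last, hl] at this
  exact this h

/-- Appending the endpoint is inverse to deleting the last vertex: when the endpoint is allowed, the
last step carries no other constraint. -/
theorem count_succ {i j : ℤ} (h : (i, j) ∉ halfLine) (n : ℕ) :
    count A i j (n + 1) = ∑ s ∈ A, count A (i - s.1) (j - s.2) n := by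
  let f : (Σ s : A, slitWalks A (i - s.1.1) (j - s.1.2) n) → slitWalks A i j (n + 1) :=
    fun q => ⟨Fin.snoc q.2.1 (i, j), snoc_mem_slitWalks A (p := (i, j)) q.1.2 h q.2.2⟩
  have hf : Function.Bijective f := by
    constructor
    · rintro ⟨⟨s, hs⟩, ⟨v, hv⟩⟩ ⟨⟨s', hs'⟩, ⟨v', hv'⟩⟩ heq
      have h1 : (Fin.snoc v (i, j) : Fin (n + 2) → ℤ × ℤ) = Fin.snoc v' (i, j) :=
        congrArg Subtype.val heq
      have h2 : v = v' := by
        have := congrArg Fin.init h1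
        rwa [Fin.init_snoc, Fin.init_snoc] at this
      subst h2
      have h3 := hv.2.1.symm.trans hv'.2.1
      rw [Prod.mk.injEq] at h3
      have h4 : s = s' := Prod.ext (by simpa using h3.1) (by simpa using h3.2)
      subst h4
      rfl
    · rintro ⟨w, h0, hl, hA, hH⟩
      have hs := hA (Fin.last n)
      rw [Fin.succ_last, hl] at hs
      refine ⟨⟨⟨_, hs⟩, ⟨Fin.init w, ?_, ?_, fun k => ?_, fun k => ?_⟩⟩, ?_⟩
      · exact h0
      · ext <;> simp [Fin.init]
      · exact hA k.castSucc
      · exact hH k.castSucc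
      · refine Subtype.ext ?_
        change Fin.snoc (Fin.init w) (i, j) = w
        rw [← hl, Fin.snoc_init_self]
  have hfin : ∀ s : A, Finite (slitWalks A (i - s.1.1) (j - s.1.2) n) := fun s =>
    (slitWalks_finite A _ _ n).to_subtype
  rw [count, ← Nat.card_coe_set_eq, ← Nat.card_congr (Equiv.ofBijective f hf), Nat.card_sigma,
    ← Finset.sum_coe_sort A fun s => count A (i - s.1) (j - s.2) n]
  rfl

variable {A}

theorem sum_symmetric {M : Type*} [AddCommMonoid M] (hA : Symmetric A) (f : ℤ × ℤ → M) :
    ∑ s ∈ A, f (s.1, -s.2) = ∑ s ∈ A, f s := by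
  refine Finset.sum_bij' (fun s _ => (s.1, -s.2)) (fun s _ => (s.1, -s.2)) ?_ ?_ ?_ ?_ ?_
  · exact fun s hs => hA _ _ hs
  · exact fun s hs => hA _ _ hs
  · simp
  · simp
  · simp

theorem count_neg (hA : Symmetric A) (i j : ℤ) (n : ℕ) : count A i (-j) n = count A i j n := by
  induction n generalizing i j with
  | zero => simp [count_zero]
  | succ n ih =>
    by_cases h : (i, j) ∈ halfLine
    · have h' : (i, -j) ∈ halfLine := ⟨h.1, by simpa using h.2⟩
      rw [count_succ_of_mem A h, count_succ_of_mem A h']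
    · have h' : (i, -j) ∉ halfLine := fun h' => h ⟨h'.1, by simpa using h'.2⟩
      rw [count_succ A h, count_succ A h', ← sum_symmetric hA]
      refine Finset.sum_congr rfl fun s _ => ?_
      rw [← ih]
      congr 1
      ring

end Recurrence

/-! ### The generating functions -/

section GeneratingFunctions

variable (A : Finset (ℤ × ℤ))

/-- The generating polynomial `∑ᵢ a_{i,j}(n) xⁱ`. -/
def walkPoly (j : ℤ) (n : ℕ) : ℝ[T;T⁻¹] :=
  .ofCoeff (Finsupp.ofSupportFinite (fun i => (count A i j n : ℝ))
    ((count_support_finite A j n).subset fun i hi => by simpa using hi))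

theorem walkPoly_coeff (i j : ℤ) (n : ℕ) : (walkPoly A j n).coeff i = count A i j n := rfl

/-- The series `S_j = ∑_{n,i} a_{i,j}(n) xⁱ tⁿ`. -/
def walkSeries (j : ℤ) : PowerSeries ℝ[T;T⁻¹] := PowerSeries.mk (walkPoly A j)

theorem coeff_laurentCoeff_walkSeries (i j : ℤ) (n : ℕ) :
    PowerSeries.coeff n (laurentCoeff i (walkSeries A j)) = count A i j n := by
  rw [coeff_laurentCoeff, walkSeries, PowerSeries.coeff_mk, walkPoly_coeff]

theorem walkSeries_neg {A} (hA : Symmetric A) (j : ℤ) : walkSeries A (-j) = walkSeries A j := by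
  ext n i
  simp only [walkSeries, PowerSeries.coeff_mk, walkPoly_coeff, count_neg hA]

/-- The series obtained from all `S_j` by appending a step, ending at height `j`. -/
def stepSeries (j : ℤ) : PowerSeries ℝ[T;T⁻¹] :=
  PowerSeries.C (stepPoly A 0) * walkSeries A j +
    PowerSeries.C (stepPoly A 1) * (walkSeries A (j - 1) + walkSeries A (j + 1))

theorem stepPoly_neg_one {A} (hA : Symmetric A) : stepPoly A (-1) = stepPoly A 1 := by
  rw [stepPoly, stepPoly, Finset.sum_filter, Finset.sum_filter, ← sum_symmetric hA]
  refine Finset.sum_congr rfl fun s _ => ?_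
  simp only [neg_inj]

/-- Small height variations leave only the ordinates `0`, `1`, `-1` for a step, and symmetry gives
the last two the same Laurent polynomial. -/
theorem coeff_stepSeries {A} (hA : Symmetric A) (hA' : SmallHeightVariations A) (i j : ℤ) (n : ℕ) :
    (PowerSeries.coeff n (stepSeries A j)).coeff i =
      ∑ s ∈ A, (count A (i - s.1) (j - s.2) n : ℝ) := by
  have h1 : ∀ h : ℤ, ((stepPoly A h) * walkPoly A (j - h) n).coeff i =
      ∑ s ∈ A with s.2 = h, (count A (i - s.1) (j - s.2) n : ℝ) := fun h => by
    rw [stepPoly, Finset.sum_mul, AddMonoidAlgebra.coeff_sum, Finset.sum_apply']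
    refine Finset.sum_congr rfl fun s hs => ?_
    rw [T_mul_coeff, walkPoly_coeff, (Finset.mem_filter.mp hs).2]
  have h2 : PowerSeries.coeff n (stepSeries A j) = stepPoly A 0 * walkPoly A (j - 0) n +
      (stepPoly A 1 * walkPoly A (j - 1) n + stepPoly A (-1) * walkPoly A (j - -1) n) := by
    rw [stepPoly_neg_one hA, sub_neg_eq_add, sub_zero, ← mul_add]
    simp [stepSeries, walkSeries]
  rw [h2, AddMonoidAlgebra.coeff_add, AddMonoidAlgebra.coeff_add, Finsupp.add_apply,
    Finsupp.add_apply, h1, h1, h1, Finset.sum_filter, Finset.sum_filter, Finset.sum_filter,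
    ← Finset.sum_add_distrib, ← Finset.sum_add_distrib]
  refine Finset.sum_congr rfl fun s hs => ?_
  have h3 := abs_le.mp (hA' s.1 s.2 hs)
  rcases (by omega : s.2 = 0 ∨ s.2 = 1 ∨ s.2 = -1) with h | h | h <;> simp [h]

/-- Off the axis no endpoint is forbidden, so the last-step decomposition needs no correction, and
the empty walk does not contribute. -/
theorem walkSeries_eq {A} (hA : Symmetric A) (hA' : SmallHeightVariations A) {j : ℤ} (hj : j ≠ 0) :
    walkSeries A j = PowerSeries.X * stepSeries A j := by
  ext n i
  rw [walkSeries, PowerSeries.coeff_mk, walkPoly_coeff]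
  rcases n with _ | n
  · simp [count_zero, hj]
  · rw [PowerSeries.coeff_succ_X_mul, coeff_stepSeries hA hA',
      count_succ A (fun h => hj h.2), Nat.cast_sum]

/-- On the axis the decomposition overcounts exactly the walks whose last step lands on the
half-line. Their abscissae are nonpositive, so the correction `B` is a series in `x̄`; the `1` is
the empty walk. -/
theorem exists_walkSeries_zero_eq {A} (hA : Symmetric A) (hA' : SmallHeightVariations A) :
    ∃ B : PowerSeries ℝ[X],
      walkSeries A 0 = 1 + PowerSeries.X * stepSeries A 0 - negEmb B := by
  obtain ⟨B, hB⟩ := exists_negEmb_eq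
    (f := 1 + PowerSeries.X * stepSeries A 0 - walkSeries A 0) fun i hi => by
      ext n
      have h1 : (1 : PowerSeries ℝ[T;T⁻¹]) = constEmb 1 := (map_one _).symm
      rw [map_sub, map_add, h1, laurentCoeff_constEmb, if_neg (ne_of_gt hi), zero_add, map_sub,
        coeff_laurentCoeff_walkSeries, coeff_laurentCoeff, map_zero]
      rcases n with _ | n
      · simp [count_zero, (ne_of_gt hi)]
      · rw [PowerSeries.coeff_succ_X_mul, coeff_stepSeries hA hA',
          count_succ A (fun h => absurd h.1 (not_le.mpr hi)), Nat.cast_sum, sub_self]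
  exact ⟨B, by rw [hB]; ring⟩

/-- A nonempty walk ending on the axis ends at a positive abscissa, so the empty walk alone
contributes at `x = 0`. -/
theorem exists_walkSeries_zero_eq_posEmb :
    ∃ s : PowerSeries ℝ[X], walkSeries A 0 = posEmb s ∧
      PowerSeries.map (Polynomial.evalRingHom 0) s = 1 := by
  have h0 : ∀ i ≤ 0, ∀ n, (count A i 0 (n + 1)) = 0 := fun i hi n =>
    count_succ_of_mem A ⟨hi, rfl⟩ n
  obtain ⟨s, hs⟩ := exists_posEmb_eq (f := walkSeries A 0) fun i hi => by
    ext n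
    rw [coeff_laurentCoeff_walkSeries]
    rcases n with _ | n
    · simp [count_zero, hi.ne]
    · simp [h0 i hi.le]
  refine ⟨s, hs.symm, ?_⟩
  rw [← laurentCoeff_zero_posEmb, hs]
  ext n
  rw [coeff_laurentCoeff_walkSeries, PowerSeries.coeff_one]
  rcases n with _ | n
  · simp [count_zero]
  · simp [h0]

end GeneratingFunctions

/-! ### Solution of the functional equation -/

section Solution

variable {A : Finset (ℤ × ℤ)}

theorem levelKernel_mul_walkSeries (hA : Symmetric A) (hA' : SmallHeightVariations A) {j : ℤ}
    (hj : j ≠ 0) : 2 * levelKernel A * walkSeries A j =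
      twoTA₁ A * (walkSeries A (j - 1) + walkSeries A (j + 1)) := by
  have h := walkSeries_eq hA hA' hj
  rw [stepSeries] at h
  rw [levelKernel, twoTA₁]
  linear_combination 2 * h

theorem X_dvd_twoTA₁ (A : Finset (ℤ × ℤ)) : PowerSeries.X ∣ twoTA₁ A :=
  ⟨2 * PowerSeries.C (stepPoly A 1), by rw [twoTA₁]; ring⟩

theorem eq_zero_of_forall_X_pow_dvd {R : Type*} [CommRing R] {f : PowerSeries R}
    (h : ∀ m, PowerSeries.X ^ m ∣ f) : f = 0 := by
  ext n
  exact PowerSeries.X_pow_dvd_iff.mp (h (n + 1)) n n.lt_succ_self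

theorem isUnit_two_mul_levelKernel (A : Finset (ℤ × ℤ)) : IsUnit (2 * levelKernel A) := by
  have h2 : IsUnit (2 : PowerSeries ℝ[T;T⁻¹]) := by
    have : IsUnit (2 : ℝ) := isUnit_iff_ne_zero.mpr two_ne_zero
    have := this.map (PowerSeries.C.comp (LaurentPolynomial.C (R := ℝ)))
    rwa [map_ofNat] at this
  refine h2.mul (isUnit_of_constantCoeff_one ?_)
  simp [levelKernel]

/-- With `z = L - r`, the equation `z² = 2Lz - T²` makes both sides satisfy one second-order
recurrence in `j`, with the same value at `j = 0`. The second boundary condition is `t`-adic: both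
sides are divisible by `tʲ`, which excludes the other root `L + r`. -/
theorem twoTA₁_pow_mul_walkSeries (hA : Symmetric A) (hA' : SmallHeightVariations A)
    {r : PowerSeries ℝ[T;T⁻¹]} (hr : r ^ 2 = deltaSeries A)
    (hr' : PowerSeries.constantCoeff r = 1) (j : ℕ) :
    twoTA₁ A ^ j * walkSeries A j = (levelKernel A - r) ^ j * walkSeries A 0 := by
  set z := levelKernel A - r with hz
  have hz2 : z ^ 2 = 2 * levelKernel A * z - twoTA₁ A ^ 2 := by
    rw [deltaSeries] at hr
    rw [hz]
    linear_combination hr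
  have hXz : PowerSeries.X ∣ z := by
    rw [PowerSeries.X_dvd_iff, hz, map_sub, hr', levelKernel]
    simp
  let d : ℕ → PowerSeries ℝ[T;T⁻¹] := fun j =>
    twoTA₁ A ^ j * walkSeries A j - z ^ j * walkSeries A 0
  have hd0 : d 0 = 0 := by simp [d]
  have hd : ∀ j : ℕ, 2 * levelKernel A * d (j + 1) = twoTA₁ A ^ 2 * d j + d (j + 2) := fun j => by
    have h := levelKernel_mul_walkSeries hA hA' (j := (j : ℤ) + 1) (by omega)
    have e1 : ((j : ℤ) + 1 - 1) = j := by ring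
    have e2 : ((j : ℤ) + 1 + 1) = j + 2 := by ring
    rw [e1, e2] at h
    simp only [d]
    push_cast
    linear_combination twoTA₁ A ^ (j + 1) * h + z ^ j * walkSeries A 0 * hz2
  -- Start: `T` and `z` are both divisible by `t`. Improvement: in `2L d_{j+1} = T² d_j + d_{j+2}`
  -- both terms on the right are divisible by `t^(m+j+2)`, one more power than was known for
  -- `d_{j+1}`, and `2L` is a unit.
  have key : ∀ m j : ℕ, PowerSeries.X ^ (m + j) ∣ d j := fun m => by
    induction m with
    | zero =>
      intro j
      rw [zero_add]
      exact dvd_sub (Dvd.dvd.mul_right (pow_dvd_pow_of_dvd (X_dvd_twoTA₁ A) j) _)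
        (Dvd.dvd.mul_right (pow_dvd_pow_of_dvd hXz j) _)
    | succ m ih =>
      rintro (_ | j)
      · rw [hd0]
        exact dvd_zero _
      · rw [← (isUnit_two_mul_levelKernel A).dvd_mul_left, hd]
        refine dvd_add ?_ ?_
        · have := mul_dvd_mul (pow_dvd_pow_of_dvd (X_dvd_twoTA₁ A) 2) (ih j)
          rw [← pow_add] at this
          refine (pow_dvd_pow _ ?_).trans this
          omega
        · refine (pow_dvd_pow _ ?_).trans (ih (j + 2))
          omega
  have : d j = 0 := eq_zero_of_forall_X_pow_dvd fun m =>
    (pow_dvd_pow _ (Nat.le_add_right m j)).trans (key m j)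
  exact sub_eq_zero.mp this

/-- Dividing `√δ S_0 = 1 - B(x̄)` by `√(DΔ̄)` leaves a series with nonnegative exponents of `x`
equal to one with nonpositive exponents; its value at `x = 0` is `1`. -/
theorem posEmb_rootPos_mul_walkSeries (hA : Symmetric A) (hA' : SmallHeightVariations A)
    {F : Triple} (hF : IsCanonicalFactorization A F) :
    posEmb (rootPos F) * walkSeries A 0 = 1 := by
  have hr' : PowerSeries.constantCoeff (posEmb (rootPos F) * negEmb (rootNeg F)) = 1 := by
    rw [map_mul, constantCoeff_posEmb_one hF.constantCoeff_rootPos,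
      constantCoeff_negEmb_one hF.constantCoeff_rootNeg, mul_one]
  have h1 := twoTA₁_pow_mul_walkSeries hA hA' hF.sq_eq_deltaSeries hr' 1
  rw [pow_one, pow_one, Nat.cast_one] at h1
  obtain ⟨B, hB⟩ := exists_walkSeries_zero_eq hA hA'
  obtain ⟨s, hs, hs0⟩ := exists_walkSeries_zero_eq_posEmb A
  -- The equation at height `0`, where `S_{-1} = S_1` and `T S_1` is replaced by `(L - √δ) S_0`.
  have h2 : posEmb (rootPos F) * negEmb (rootNeg F) * walkSeries A 0 = 1 - negEmb B := by
    have h3 := walkSeries_neg hA 1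
    rw [stepSeries, zero_sub, zero_add, h3] at hB
    rw [twoTA₁, levelKernel] at h1
    linear_combination h1 + hB
  obtain ⟨N, hN⟩ := (isUnit_of_constantCoeff_one hF.constantCoeff_rootNeg).exists_right_inv
  have hN1 : negEmb (rootNeg F) * negEmb N = 1 := by rw [← map_mul, hN, map_one]
  have h4 : posEmb (rootPos F * s) = negEmb ((1 - B) * N) := by
    rw [map_mul, map_mul, map_sub, map_one, ← hs]
    linear_combination negEmb N * h2 - posEmb (rootPos F) * walkSeries A 0 * hN1
  have h5 := posEmb_eq_negEmb h4
  rw [map_mul (PowerSeries.map _), hF.rootPos_x_zero, hs0, mul_one, map_one, map_mul, ← hs] at h5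
  exact h5

theorem sum_range_even_add_odd {M : Type*} [AddCommMonoid M] (f : ℕ → M) (N : ℕ) :
    ∑ m ∈ Finset.range N, f m = ∑ k ∈ Finset.range ((N + 1) / 2), f (2 * k) +
      ∑ k ∈ Finset.range (N / 2), f (2 * k + 1) := by
  induction N with
  | zero => simp
  | succ N ih =>
    rw [Finset.sum_range_succ, ih]
    rcases Nat.even_or_odd' N with ⟨c, rfl | rfl⟩
    · rw [show (2 * c + 1 + 1) / 2 = c + 1 by omega, show (2 * c + 1) / 2 = c by omega,
        show 2 * c / 2 = c by omega, Finset.sum_range_succ]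
      abel
    · rw [show (2 * c + 1 + 1 + 1) / 2 = c + 1 by omega, show (2 * c + 1 + 1) / 2 = c + 1 by omega,
        show (2 * c + 1) / 2 = c by omega, Finset.sum_range_succ (fun k => f (2 * k + 1)) c]
      abel

theorem sub_pow_eq_even_sub_odd {R : Type*} [CommRing R] (l r : R) (j : ℕ) :
    (l - r) ^ j =
      (∑ k ∈ Finset.range (j / 2 + 1), (j.choose (2 * k) : R) * (r ^ 2) ^ k * l ^ (j - 2 * k)) -
        r * ∑ k ∈ Finset.range ((j + 1) / 2),
          (j.choose (2 * k + 1) : R) * (r ^ 2) ^ k * l ^ (j - 2 * k - 1) := by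
  rw [sub_eq_neg_add, add_pow, sum_range_even_add_odd, show (j + 1 + 1) / 2 = j / 2 + 1 by omega,
    Finset.mul_sum, sub_eq_add_neg, ← Finset.sum_neg_distrib]
  congr 1
  · refine Finset.sum_congr rfl fun k _ => ?_
    rw [pow_mul (-r), neg_sq]
    ring
  · refine Finset.sum_congr rfl fun k _ => ?_
    rw [pow_succ (-r), pow_mul (-r), neg_sq, Nat.sub_sub]
    ring

/-- `f_j⁺`, as a series with Laurent polynomial coefficients. -/
def fPlusSeries (A : Finset (ℤ × ℤ)) (j : ℕ) : PowerSeries ℝ[T;T⁻¹] :=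
  ∑ k ∈ Finset.range (j / 2 + 1),
    (j.choose (2 * k) : PowerSeries ℝ[T;T⁻¹]) * deltaSeries A ^ k * levelKernel A ^ (j - 2 * k)

/-- `f_j⁻`, as a series with Laurent polynomial coefficients. -/
def fMinusSeries (A : Finset (ℤ × ℤ)) (j : ℕ) : PowerSeries ℝ[T;T⁻¹] :=
  ∑ k ∈ Finset.range ((j + 1) / 2),
    (j.choose (2 * k + 1) : PowerSeries ℝ[T;T⁻¹]) * deltaSeries A ^ k *
      levelKernel A ^ (j - 2 * k - 1)

theorem toSeriesXT_fPlusSeries (j : ℕ) : toSeriesXT (fPlusSeries A j) = fPlus A j := by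
  simp only [fPlusSeries, fPlus, map_sum, map_mul, map_pow, map_natCast, toSeriesXT_deltaSeries,
    toSeriesXT_levelKernel]

theorem toSeriesXT_fMinusSeries (j : ℕ) : toSeriesXT (fMinusSeries A j) = fMinus A j := by
  simp only [fMinusSeries, fMinus, map_sum, map_mul, map_pow, map_natCast, toSeriesXT_deltaSeries,
    toSeriesXT_levelKernel]

/-- `(2tA₁)ʲ S_j = f_j⁺ / √Δ - f_j⁻ √(DΔ̄)`, where `S_0 = 1 / √Δ`. -/
theorem twoTA₁_pow_mul_walkSeries_eq (hA : Symmetric A) (hA' : SmallHeightVariations A)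
    {F : Triple} (hF : IsCanonicalFactorization A F) (j : ℕ) :
    twoTA₁ A ^ j * walkSeries A j =
      fPlusSeries A j * walkSeries A 0 - fMinusSeries A j * negEmb (rootNeg F) := by
  have hr' : PowerSeries.constantCoeff (posEmb (rootPos F) * negEmb (rootNeg F)) = 1 := by
    rw [map_mul, constantCoeff_posEmb_one hF.constantCoeff_rootPos,
      constantCoeff_negEmb_one hF.constantCoeff_rootNeg, mul_one]
  rw [twoTA₁_pow_mul_walkSeries hA hA' hF.sq_eq_deltaSeries hr', sub_pow_eq_even_sub_odd,
    hF.sq_eq_deltaSeries, ← fPlusSeries, ← fMinusSeries]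
  linear_combination (-fMinusSeries A j * negEmb (rootNeg F)) *
    posEmb_rootPos_mul_walkSeries hA hA' hF

end Solution

/-! ### Power series over a subfield -/

section SeriesOver

variable {K : Type*} [Field K] (k : Subfield K)

/-- The power series with coefficients in the subfield `k`. -/
def seriesOver : Subring (PowerSeries K) := (PowerSeries.map k.subtype).range

variable {k}

theorem mem_seriesOver {f : PowerSeries K} : f ∈ seriesOver k ↔ ∀ n, PowerSeries.coeff n f ∈ k := by
  constructor
  · rintro ⟨g, rfl⟩ n
    rw [PowerSeries.coeff_map]
    exact (PowerSeries.coeff n g).2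
  · intro h
    refine ⟨PowerSeries.mk fun n => ⟨_, h n⟩, ?_⟩
    ext n
    simp

theorem C_mem_seriesOver {c : K} (hc : c ∈ k) : PowerSeries.C c ∈ seriesOver k :=
  ⟨PowerSeries.C ⟨c, hc⟩, by simp⟩

/-- A `k`-linear projection of `K` along `k`. -/
theorem exists_linearMap_ker_eq (k : Subfield K) : ∃ ρ : K →ₗ[k] K, ∀ a, ρ a = 0 ↔ a ∈ k := by
  obtain ⟨π, hπ⟩ := LinearMap.exists_leftInverse_of_injective (Algebra.linearMap k K)
    (LinearMap.ker_eq_bot.mpr (algebraMap k K).injective)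
  refine ⟨LinearMap.id - (Algebra.linearMap k K) ∘ₗ π, fun a => ⟨fun h => ?_, fun h => ?_⟩⟩
  · have h' : a = algebraMap k K (π a) := by simpa [sub_eq_zero] using h
    rw [h']
    exact (π a).2
  · have h' := LinearMap.congr_fun hπ ⟨a, h⟩
    have h'' : π a = ⟨a, h⟩ := h'
    simp only [LinearMap.sub_apply, LinearMap.id_apply, LinearMap.comp_apply, h'']
    exact sub_self a

/-- Apply a linear map to all coefficients. -/
def mapCoeff (ρ : K →ₗ[k] K) : PowerSeries K →+ PowerSeries K where
  toFun f := PowerSeries.mk fun n => ρ (PowerSeries.coeff n f)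
  map_zero' := by ext; simp
  map_add' f g := by ext; simp

theorem coeff_mapCoeff (ρ : K →ₗ[k] K) (f : PowerSeries K) (n : ℕ) :
    PowerSeries.coeff n (mapCoeff ρ f) = ρ (PowerSeries.coeff n f) := by
  simp [mapCoeff]

theorem map_mul_of_mem (ρ : K →ₗ[k] K) {c : K} (hc : c ∈ k) (a : K) : ρ (c * a) = c * ρ a :=
  ρ.map_smul (⟨c, hc⟩ : k) a

theorem mapCoeff_mul (ρ : K →ₗ[k] K) {f : PowerSeries K} (hf : f ∈ seriesOver k)
    (g : PowerSeries K) : mapCoeff ρ (f * g) = f * mapCoeff ρ g := by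
  ext n
  rw [coeff_mapCoeff, PowerSeries.coeff_mul, PowerSeries.coeff_mul, map_sum]
  refine Finset.sum_congr rfl fun p _ => ?_
  rw [map_mul_of_mem ρ (mem_seriesOver.mp hf _), coeff_mapCoeff]

theorem mapCoeff_eq_zero_iff {ρ : K →ₗ[k] K} (hρ : ∀ a, ρ a = 0 ↔ a ∈ k) {f : PowerSeries K} :
    mapCoeff ρ f = 0 ↔ f ∈ seriesOver k := by
  rw [mem_seriesOver, PowerSeries.ext_iff]
  simp only [coeff_mapCoeff, map_zero, hρ]

/-- For a `k`-linear `ρ` with kernel `k`, applied to coefficients, `f ρ(g) = ρ(fg) = 0`, hence `ρ(g)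
= 0`. No inverse of `f` is needed, so `f` may have zero constant term. -/
theorem mem_seriesOver_of_mul_mem {f g : PowerSeries K} (hf : f ∈ seriesOver k) (hf0 : f ≠ 0)
    (hfg : f * g ∈ seriesOver k) : g ∈ seriesOver k := by
  obtain ⟨ρ, hρ⟩ := exists_linearMap_ker_eq k
  rw [← mapCoeff_eq_zero_iff hρ] at hfg ⊢
  rw [mapCoeff_mul ρ hf] at hfg
  exact (mul_eq_zero.mp hfg).resolve_left hf0

/-- The coefficient of index `n + 1` of `f²` is `2 f₀ f_{n+1}` plus products of earlier
coefficients, and `2 f₀` is invertible in `k`. -/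
theorem mem_seriesOver_of_sq_mem [CharZero K] {f : PowerSeries K} (hf : f ^ 2 ∈ seriesOver k)
    (h0 : PowerSeries.constantCoeff f ∈ k) (h0' : PowerSeries.constantCoeff f ≠ 0) :
    f ∈ seriesOver k := by
  rw [mem_seriesOver] at hf ⊢
  intro n
  induction n using Nat.strong_induction_on with
  | _ n ih =>
    rcases n with _ | n
    · rwa [PowerSeries.coeff_zero_eq_constantCoeff_apply]
    have h1 := hf (n + 1)
    rw [sq, PowerSeries.coeff_mul, Finset.Nat.sum_antidiagonal_eq_sum_range_succ_mk,
      Finset.sum_range_succ, Finset.sum_range_succ'] at h1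
    simp only [Nat.sub_self, Nat.sub_zero, PowerSeries.coeff_zero_eq_constantCoeff_apply] at h1
    have h2 : ∑ i ∈ Finset.range n, PowerSeries.coeff (i + 1) f *
        PowerSeries.coeff (n + 1 - (i + 1)) f ∈ k := by
      refine sum_mem fun i hi => ?_
      have hi' := Finset.mem_range.mp hi
      exact mul_mem (ih _ (by omega)) (ih _ (by omega))
    have h3 : 2 * PowerSeries.constantCoeff f * PowerSeries.coeff (n + 1) f ∈ k := by
      have := sub_mem h1 h2
      convert this using 1
      ring
    have h4 : 2 * PowerSeries.constantCoeff f ≠ 0 := mul_ne_zero two_ne_zero h0'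
    have h5 := mul_mem (inv_mem (mul_mem (ofNat_mem k 2) h0)) h3
    rwa [inv_mul_cancel_left₀ h4] at h5

theorem taylor_coeff_eq_sum (α : K) (f : K[X]) {N : ℕ} (hN : f.natDegree < N) (n : ℕ) :
    (Polynomial.taylor α f).coeff n =
      ∑ i ∈ Finset.range N, f.coeff i * ((Polynomial.X + Polynomial.C α) ^ i).coeff n := by
  conv_lhs => rw [f.as_sum_range' N hN]
  rw [map_sum, Polynomial.finsetSum_coeff]
  refine Finset.sum_congr rfl fun i _ => ?_
  rw [Polynomial.taylor_monomial, Polynomial.coeff_C_mul]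

theorem X_add_C_pow_coeff_mem {α : K} (hα : α ∈ k) (i n : ℕ) :
    ((Polynomial.X + Polynomial.C α) ^ i).coeff n ∈ k := by
  rw [Polynomial.coeff_X_add_C_pow]
  exact mul_mem (pow_mem hα _) (natCast_mem k _)

theorem taylor_mem_seriesOver {α : K} (hα : α ∈ k) {f : K[X]} (hf : ∀ n, f.coeff n ∈ k) :
    ((Polynomial.taylor α f : K[X]) : PowerSeries K) ∈ seriesOver k := by
  rw [mem_seriesOver]
  intro n
  rw [Polynomial.coeff_coe, taylor_coeff_eq_sum α f (Nat.lt_succ_self _)]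
  exact sum_mem fun i _ => mul_mem (hf i) (X_add_C_pow_coeff_mem hα i n)

/-- For `α` in `k` the change of variable `x ↦ x + α` is `k`-linear on coefficients with matrix over
`k`, so it commutes with `ρ`. -/
theorem exists_polynomial_mapCoeff (ρ : K →ₗ[k] K) (f : K[X]) :
    ∃ g : K[X], (∀ n, g.coeff n = ρ (f.coeff n)) ∧ ∀ α ∈ k,
      ((Polynomial.taylor α g : K[X]) : PowerSeries K) =
        mapCoeff ρ (Polynomial.taylor α f : K[X]) := by
  have h1 : ∀ n, (∑ i ∈ Finset.range (f.natDegree + 1),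
      Polynomial.monomial i (ρ (f.coeff i))).coeff n = ρ (f.coeff n) := fun n => by
    rw [Polynomial.finsetSum_coeff]
    simp only [Polynomial.coeff_monomial, Finset.sum_ite_eq', Finset.mem_range]
    split_ifs with h
    · rfl
    · rw [Polynomial.coeff_eq_zero_of_natDegree_lt (by omega), map_zero]
  set g := ∑ i ∈ Finset.range (f.natDegree + 1), Polynomial.monomial i (ρ (f.coeff i))
  have hg : g.natDegree < f.natDegree + 1 := by
    rw [Nat.lt_succ_iff, Polynomial.natDegree_le_iff_coeff_eq_zero]
    intro n hn
    rw [h1, Polynomial.coeff_eq_zero_of_natDegree_lt hn, map_zero]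
  refine ⟨g, h1, fun α hα => ?_⟩
  ext n
  rw [coeff_mapCoeff, Polynomial.coeff_coe, Polynomial.coeff_coe, taylor_coeff_eq_sum α g hg,
    taylor_coeff_eq_sum α f (Nat.lt_succ_self _), map_sum]
  refine Finset.sum_congr rfl fun i _ => ?_
  rw [h1, mul_comm (f.coeff i), map_mul_of_mem ρ (X_add_C_pow_coeff_mem hα i n), mul_comm]

/-- Hermite interpolation: a polynomial whose high coefficients lie in `k`, and whose residue
modulo a split polynomial `W` over `k` is given around each root of `W` by a series over `k`, has
all its coefficients in `k`. -/
theorem coeff_mem_of_congruent {G W : K[X]} (hW : ∀ n, W.coeff n ∈ k)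
    (hsplit : W.Splits) (hhigh : ∀ n, W.natDegree ≤ n → G.coeff n ∈ k)
    (hroot : ∀ α, W.IsRoot α → α ∈ k ∧ ∃ h ∈ seriesOver k, ∃ q : PowerSeries K,
      ((Polynomial.taylor α G : K[X]) : PowerSeries K) =
        h + ((Polynomial.taylor α W : K[X]) : PowerSeries K) * q) (n : ℕ) : G.coeff n ∈ k := by
  obtain ⟨ρ, hρ⟩ := exists_linearMap_ker_eq k
  obtain ⟨Q, hQ, hQt⟩ := exists_polynomial_mapCoeff ρ G
  suffices hQ0 : Q = 0 by
    rw [← hρ, ← hQ, hQ0, Polynomial.coeff_zero]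
  by_contra hQ0
  -- `ρ` annihilates the coefficients of `G` of degree at least `deg W`.
  have hdeg : Q.natDegree < W.natDegree := by
    by_contra! hle
    have h1 := hQ Q.natDegree
    rw [(hρ _).mpr (hhigh _ hle)] at h1
    exact hQ0 (Polynomial.leadingCoeff_eq_zero.mp h1)
  -- Around a root `α` of `W`, applying `ρ` kills `h` and gives `Q = W ρ(q)`, so `Q` vanishes at `α`
  -- at least to the order of `W`.
  have hle : W.roots ≤ Q.roots := by
    classical
    rw [Multiset.le_iff_count]
    intro α
    rw [Polynomial.count_roots, Polynomial.count_roots]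
    by_cases hα : W.IsRoot α
    · obtain ⟨hαk, h, hh, q, hGq⟩ := hroot α hα
      have h1 : ((Polynomial.taylor α Q : K[X]) : PowerSeries K) =
          ((Polynomial.taylor α W : K[X]) : PowerSeries K) * mapCoeff ρ q := by
        rw [hQt α hαk, hGq, map_add, mapCoeff_mul ρ (taylor_mem_seriesOver hαk hW),
          (mapCoeff_eq_zero_iff hρ).mpr hh, zero_add]
      rw [Polynomial.le_rootMultiplicity_iff hQ0, Polynomial.X_sub_C_pow_dvd_iff]
      have h2 := Polynomial.X_sub_C_pow_dvd_iff.mp (Polynomial.pow_rootMultiplicity_dvd W α)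
      rw [← Polynomial.taylor_apply] at h2 ⊢
      obtain ⟨w, hw⟩ := h2
      rw [hw, Polynomial.coe_mul, Polynomial.coe_pow, Polynomial.coe_X, mul_assoc] at h1
      have h3 := PowerSeries.X_pow_dvd_iff.mp ⟨_, h1⟩
      rw [Polynomial.X_pow_dvd_iff]
      intro d hd
      rw [← Polynomial.coeff_coe]
      exact h3 d hd
    · rw [Polynomial.rootMultiplicity_eq_zero hα]
      exact Nat.zero_le _
  -- As `W` splits, `Q` would have at least `deg W` roots with multiplicity, more than its degree.
  have h1 := Multiset.card_le_card hle
  rw [← hsplit.natDegree_eq_card_roots] at h1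
  exact absurd (h1.trans Q.card_roots') (not_le.mpr hdeg)

end SeriesOver

/-! ### Expansion around a complex number -/

section Expansion

/-- Exchange of the two variables of a series. -/
def exchange {R : Type*} [CommRing R] :
    PowerSeries (PowerSeries R) →+* PowerSeries (PowerSeries R) where
  toFun f := PowerSeries.mk fun k => PowerSeries.mk fun n =>
    PowerSeries.coeff k (PowerSeries.coeff n f)
  map_zero' := by ext; simp
  map_add' f g := by ext; simp
  map_one' := by
    ext k n
    simp only [PowerSeries.coeff_mk, PowerSeries.coeff_one]
    by_cases hk : k = 0 <;> by_cases hn : n = 0 <;> simp [hk, hn, PowerSeries.coeff_one]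
  map_mul' f g := by
    ext k n
    simp only [PowerSeries.coeff_mk, PowerSeries.coeff_mul, map_sum]
    rw [Finset.sum_comm]

theorem coeff_coeff_exchange {R : Type*} [CommRing R] (f : PowerSeries (PowerSeries R)) (k n : ℕ) :
    PowerSeries.coeff n (PowerSeries.coeff k (exchange f)) =
      PowerSeries.coeff k (PowerSeries.coeff n f) := by
  simp [exchange]

/-- The expansion of a real polynomial in powers of `x - α`. -/
def expandPoly (α : ℂ) : ℝ[X] →+* PowerSeries ℂ :=
  (Polynomial.coeToPowerSeries.ringHom.comp (Polynomial.taylorAlgHom α : ℂ[X] →+* ℂ[X])).comp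
    (Polynomial.mapRingHom Complex.ofRealHom)

theorem expandPoly_apply (α : ℂ) (p : ℝ[X]) :
    expandPoly α p = (Polynomial.taylor α (p.map Complex.ofRealHom) : ℂ[X]) := rfl

/-- The expansion of a series with polynomial coefficients in powers of `u = x - α`. -/
def expand (α : ℂ) : PowerSeries ℝ[X] →+* PowerSeries SeriesT :=
  ((PowerSeries.map (HahnSeries.ofPowerSeries ℤ ℂ)).comp exchange).comp
    (PowerSeries.map (expandPoly α))

theorem coeff_expand (α : ℂ) (f : PowerSeries ℝ[X]) (k : ℕ) :
    PowerSeries.coeff k (expand α f) = HahnSeries.ofPowerSeries ℤ ℂ (PowerSeries.mk fun n =>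
      PowerSeries.coeff k (expandPoly α (PowerSeries.coeff n f))) := by
  rw [expand, RingHom.comp_apply, RingHom.comp_apply, PowerSeries.coeff_map]
  congr 1
  ext n
  rw [coeff_coeff_exchange, PowerSeries.coeff_map, PowerSeries.coeff_mk]

/-- The inclusion of `ℝ[[t]]` in `ℂ((t))`, as a ring homomorphism. -/
def ofRealSeriesHom : PowerSeries ℝ →+* SeriesT :=
  (HahnSeries.ofPowerSeries ℤ ℂ).comp (PowerSeries.map Complex.ofRealHom)

theorem ofRealSeriesHom_apply (c : PowerSeries ℝ) : ofRealSeriesHom c = ofRealSeries c := rfl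

theorem ofRealSeriesHom_injective : Function.Injective ofRealSeriesHom := by
  intro f g h
  have h' : HahnSeries.ofPowerSeries ℤ ℂ (PowerSeries.map Complex.ofRealHom f) =
    HahnSeries.ofPowerSeries ℤ ℂ (PowerSeries.map Complex.ofRealHom g) := h
  exact PowerSeries.map_injective _ Complex.ofRealHom.injective
    (HahnSeries.ofPowerSeries_injective h')

theorem ofRealSeriesHom_X : ofRealSeriesHom PowerSeries.X = tT := by
  rw [ofRealSeriesHom, RingHom.comp_apply, PowerSeries.map_X, HahnSeries.ofPowerSeries_X, tT]

theorem expand_C (α : ℂ) (p : ℝ[X]) :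
    expand α (PowerSeries.C p) = (Polynomial.taylor (HahnSeries.C α : SeriesT)
      (p.map (HahnSeries.C.comp Complex.ofRealHom)) : SeriesT[X]) := by
  ext k : 1
  rw [coeff_expand, Polynomial.coeff_coe, ← Polynomial.map_map, ← Polynomial.map_taylor,
    Polynomial.coeff_map, ← Polynomial.coeff_coe, ← expandPoly_apply, ← HahnSeries.ofPowerSeries_C]
  congr 1
  ext n
  rw [PowerSeries.coeff_mk, PowerSeries.coeff_C, PowerSeries.coeff_C]
  split_ifs <;> simp

theorem expand_map_C (α : ℂ) (c : PowerSeries ℝ) :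
    expand α (PowerSeries.map Polynomial.C c) = PowerSeries.C (ofRealSeriesHom c) := by
  ext k : 1
  rw [coeff_expand, PowerSeries.coeff_C]
  split_ifs with h
  · subst h
    rw [ofRealSeriesHom, RingHom.comp_apply]
    congr 1
    ext n
    simp [expandPoly_apply]
  · rw [← map_zero (HahnSeries.ofPowerSeries ℤ ℂ)]
    congr 1
    ext n
    rw [PowerSeries.coeff_mk, PowerSeries.coeff_map, expandPoly_apply, Polynomial.map_C,
      Polynomial.taylor_C, Polynomial.coe_C, PowerSeries.coeff_C, if_neg h, map_zero]

theorem expand_X (α : ℂ) : expand α PowerSeries.X = PowerSeries.C tT := by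
  rw [← ofRealSeriesHom_X, ← expand_map_C, PowerSeries.map_X]

theorem constantCoeff_expand (α : ℂ) (f : PowerSeries ℝ[X]) :
    PowerSeries.constantCoeff (expand α f) = ((evalAt α f : PowerSeries ℂ) : LaurentSeries ℂ) := by
  rw [← PowerSeries.coeff_zero_eq_constantCoeff_apply, coeff_expand]
  congr 1
  ext n
  rw [PowerSeries.coeff_mk, evalAt, PowerSeries.coeff_map, expandPoly_apply, Polynomial.coeff_coe,
    Polynomial.taylor_coeff_zero, Polynomial.eval_map]
  rfl

theorem coeff_expand_zero (f : PowerSeries ℝ[X]) (k : ℕ) :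
    PowerSeries.coeff k (expand 0 f) = ofRealSeriesHom (laurentCoeff k (posEmb f)) := by
  rw [coeff_expand, ofRealSeriesHom, RingHom.comp_apply]
  congr 1
  ext n
  rw [PowerSeries.coeff_mk, expandPoly_apply, Polynomial.coeff_coe, Polynomial.taylor_zero,
    Polynomial.coeff_map, laurentCoeff_posEmb_natCast, PowerSeries.coeff_map, PowerSeries.coeff_mk]

theorem expand_zero_injective : Function.Injective (expand 0) := by
  intro f g h
  refine posEmb_injective (ext_laurentCoeff fun i => ?_)
  rcases lt_or_ge i 0 with hi | hi
  · rw [laurentCoeff_posEmb_of_neg _ hi, laurentCoeff_posEmb_of_neg _ hi]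
  · lift i to ℕ using hi
    refine ofRealSeriesHom_injective ?_
    rw [← coeff_expand_zero, ← coeff_expand_zero, h]

/-- The series whose expansion around each element of `Z` has its coefficients in `k`. -/
def expansionRing (k : Subfield SeriesT) (Z : Set ℂ) : Subring (PowerSeries ℝ[X]) :=
  ⨅ α ∈ Z, (seriesOver k).comap (expand α)

variable {k : Subfield SeriesT} {Z : Set ℂ}

theorem mem_expansionRing {f : PowerSeries ℝ[X]} :
    f ∈ expansionRing k Z ↔ ∀ α ∈ Z, expand α f ∈ seriesOver k := by
  simp [expansionRing, Subring.mem_iInf]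

theorem C_mem_expansionRing (hZ : ∀ α ∈ Z, (HahnSeries.C α : SeriesT) ∈ k) {p : ℝ[X]}
    (hp : ∀ n, (HahnSeries.C (p.coeff n : ℂ) : SeriesT) ∈ k) :
    PowerSeries.C p ∈ expansionRing k Z := by
  rw [mem_expansionRing]
  intro α hα
  rw [expand_C]
  refine taylor_mem_seriesOver (hZ α hα) fun n => ?_
  rw [Polynomial.coeff_map]
  exact hp n

theorem C_X_mem_expansionRing (hZ : ∀ α ∈ Z, (HahnSeries.C α : SeriesT) ∈ k) :
    PowerSeries.C Polynomial.X ∈ expansionRing k Z := by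
  refine C_mem_expansionRing hZ fun n => ?_
  rw [Polynomial.coeff_X]
  split_ifs <;> simp

theorem X_mem_expansionRing (ht : tT ∈ k) : PowerSeries.X ∈ expansionRing k Z := by
  rw [mem_expansionRing]
  intro α _
  rw [expand_X]
  exact C_mem_seriesOver ht

theorem map_C_mem_expansionRing {c : PowerSeries ℝ} (hc : ofRealSeries c ∈ k) :
    PowerSeries.map Polynomial.C c ∈ expansionRing k Z := by
  rw [mem_expansionRing]
  intro α _
  rw [expand_map_C]
  exact C_mem_seriesOver hc

/-- Around each `α`, the expansion of `f` is determined by that of `f²` and by the value at `α`;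
this is why adjoining the values `√Δ(α;t)` suffices. The value at `α` is nonzero because it is `1`
at `t = 0`. -/
theorem sqrt_mem_expansionRing {f : PowerSeries ℝ[X]} (hf : f ^ 2 ∈ expansionRing k Z)
    (h1 : PowerSeries.constantCoeff f = 1)
    (hα : ∀ α ∈ Z, ((evalAt α f : PowerSeries ℂ) : LaurentSeries ℂ) ∈ k) :
    f ∈ expansionRing k Z := by
  rw [mem_expansionRing] at hf ⊢
  intro α hαZ
  have h2 := hf α hαZ
  rw [map_pow] at h2
  have h3 := constantCoeff_expand α f
  have : CharZero SeriesT := algebraRat.charZero SeriesT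
  refine mem_seriesOver_of_sq_mem h2 (h3 ▸ hα α hαZ) ?_
  rw [h3]
  intro h0
  have h4 : evalAt α f = 0 :=
    HahnSeries.ofPowerSeries_injective (h0.trans (map_zero (HahnSeries.ofPowerSeries ℤ ℂ)).symm)
  have h5 : PowerSeries.constantCoeff (evalAt α f) = 1 := constantCoeff_map_one _ h1
  rw [h4, map_zero] at h5
  exact zero_ne_one h5

theorem inv_mem_expansionRing {f g : PowerSeries ℝ[X]} (hf : f ∈ expansionRing k Z)
    (hfg : f * g = 1) : g ∈ expansionRing k Z := by
  rw [mem_expansionRing] at hf ⊢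
  intro α hα
  have h1 : expand α f * expand α g = 1 := by rw [← map_mul, hfg, map_one]
  exact mem_seriesOver_of_mul_mem (hf α hα) (left_ne_zero_of_mul_eq_one h1)
    (h1 ▸ one_mem _)

theorem mem_expansionRing_zero {f : PowerSeries ℝ[X]} :
    f ∈ expansionRing k {0} ↔ ∀ i, ofRealSeriesHom (laurentCoeff i (posEmb f)) ∈ k := by
  rw [mem_expansionRing]
  simp only [Set.mem_singleton_iff, forall_eq, mem_seriesOver, coeff_expand_zero]
  refine ⟨fun h i => ?_, fun h i => h i⟩
  rcases lt_or_ge i 0 with hi | hi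
  · rw [laurentCoeff_posEmb_of_neg _ hi, map_zero]
    exact zero_mem _
  · lift i to ℕ using hi
    exact h i

/-- The series which, multiplied by a power of `x`, belong to a given ring of series with
polynomial coefficients. -/
def laurentRing (V : Subring (PowerSeries ℝ[X])) (hV : PowerSeries.C Polynomial.X ∈ V) :
    Subring (PowerSeries ℝ[T;T⁻¹]) where
  carrier := {f | ∃ N : ℕ, ∃ p ∈ V, monomialX N * f = posEmb p}
  mul_mem' := by
    rintro f g ⟨N, p, hp, hf⟩ ⟨M, q, hq, hg⟩
    refine ⟨N + M, p * q, mul_mem hp hq, ?_⟩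
    rw [Nat.cast_add, monomialX_add, map_mul, ← hf, ← hg]
    ring
  one_mem' := ⟨0, 1, one_mem _, by simp⟩
  add_mem' := by
    rintro f g ⟨N, p, hp, hf⟩ ⟨M, q, hq, hg⟩
    refine ⟨N + M, PowerSeries.C Polynomial.X ^ M * p + PowerSeries.C Polynomial.X ^ N * q,
      add_mem (mul_mem (pow_mem hV _) hp) (mul_mem (pow_mem hV _) hq), ?_⟩
    rw [Nat.cast_add, monomialX_add, map_add, map_mul, map_mul, ← hf, ← hg, ← map_pow, ← map_pow,
      ← monomialX_natCast, ← monomialX_natCast]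
    ring
  zero_mem' := ⟨0, 0, zero_mem _, by simp⟩
  neg_mem' := by
    rintro f ⟨N, p, hp, hf⟩
    exact ⟨N, -p, neg_mem hp, by rw [map_neg, ← hf, mul_neg]⟩

theorem laurentRing_mono {V W : Subring (PowerSeries ℝ[X])}
    {hV : PowerSeries.C Polynomial.X ∈ V} {hW : PowerSeries.C Polynomial.X ∈ W} (h : V ≤ W) :
    laurentRing V hV ≤ laurentRing W hW :=
  fun _ ⟨N, p, hp, hf⟩ => ⟨N, p, h hp, hf⟩

theorem posEmb_mem_laurentRing {V : Subring (PowerSeries ℝ[X])}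
    {hV : PowerSeries.C Polynomial.X ∈ V} {p : PowerSeries ℝ[X]} (hp : p ∈ V) :
    posEmb p ∈ laurentRing V hV := ⟨0, p, hp, by simp⟩

theorem monomialX_mem_laurentRing {V : Subring (PowerSeries ℝ[X])}
    {hV : PowerSeries.C Polynomial.X ∈ V} (i : ℤ) : monomialX i ∈ laurentRing V hV := by
  rcases le_total 0 i with hi | hi
  · lift i to ℕ using hi
    rw [monomialX_natCast, map_pow]
    exact posEmb_mem_laurentRing (pow_mem hV _)
  · obtain ⟨n, rfl⟩ := Int.exists_eq_neg_ofNat hi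
    refine ⟨n, 1, one_mem _, ?_⟩
    rw [map_one, mul_comm, monomialX_neg_mul]

theorem X_mem_laurentRing {V : Subring (PowerSeries ℝ[X])}
    {hV : PowerSeries.C Polynomial.X ∈ V} (hX : PowerSeries.X ∈ V) :
    PowerSeries.X ∈ laurentRing V hV :=
  ⟨0, PowerSeries.X, hX, by simp [posEmb]⟩

/-! ### Subrings containing the kernel and the series `f_j⁺`, `f_j⁻` -/

section

variable {V : Subring (PowerSeries ℝ[T;T⁻¹])} (hx : ∀ i, monomialX i ∈ V) (hX : PowerSeries.X ∈ V)
  (A : Finset (ℤ × ℤ))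

include hx

theorem C_stepPoly_mem (h : ℤ) : PowerSeries.C (stepPoly A h) ∈ V := by
  rw [stepPoly, map_sum]
  exact sum_mem fun s _ => hx s.1

include hX

theorem levelKernel_mem : levelKernel A ∈ V :=
  sub_mem (one_mem _) (mul_mem hX (C_stepPoly_mem hx A 0))

theorem twoTA₁_mem : twoTA₁ A ∈ V :=
  mul_mem (mul_mem (ofNat_mem _ 2) hX) (C_stepPoly_mem hx A 1)

theorem deltaSeries_mem : deltaSeries A ∈ V :=
  mul_mem (sub_mem (levelKernel_mem hx hX A) (twoTA₁_mem hx hX A))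
    (add_mem (levelKernel_mem hx hX A) (twoTA₁_mem hx hX A))

theorem fPlusSeries_mem (j : ℕ) : fPlusSeries A j ∈ V :=
  sum_mem fun _ _ => mul_mem (mul_mem (natCast_mem _ _)
    (pow_mem (deltaSeries_mem hx hX A) _)) (pow_mem (levelKernel_mem hx hX A) _)

theorem fMinusSeries_mem (j : ℕ) : fMinusSeries A j ∈ V :=
  sum_mem fun _ _ => mul_mem (mul_mem (natCast_mem _ _)
    (pow_mem (deltaSeries_mem hx hX A) _)) (pow_mem (levelKernel_mem hx hX A) _)

end

/-- The series `f` such that `f(x⁻¹;t)` belongs to `laurentRing V hV`. -/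
def swapRing (V : Subring (PowerSeries ℝ[X])) (hV : PowerSeries.C Polynomial.X ∈ V) :
    Subring (PowerSeries ℝ[T;T⁻¹]) := (laurentRing V hV).comap swapX

theorem mem_swapRing {V : Subring (PowerSeries ℝ[X])} {hV : PowerSeries.C Polynomial.X ∈ V}
    {f : PowerSeries ℝ[T;T⁻¹]} : f ∈ swapRing V hV ↔ swapX f ∈ laurentRing V hV := Iff.rfl

theorem monomialX_mem_swapRing {V : Subring (PowerSeries ℝ[X])}
    {hV : PowerSeries.C Polynomial.X ∈ V} (i : ℤ) : monomialX i ∈ swapRing V hV := by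
  rw [mem_swapRing, swapX_monomialX]
  exact monomialX_mem_laurentRing _

theorem X_mem_swapRing {V : Subring (PowerSeries ℝ[X])}
    {hV : PowerSeries.C Polynomial.X ∈ V} (hX : PowerSeries.X ∈ V) :
    PowerSeries.X ∈ swapRing V hV := by
  rw [mem_swapRing, swapX_X]
  exact X_mem_laurentRing hX

theorem negEmb_mem_swapRing {V : Subring (PowerSeries ℝ[X])}
    {hV : PowerSeries.C Polynomial.X ∈ V} {p : PowerSeries ℝ[X]} (hp : p ∈ V) :
    negEmb p ∈ swapRing V hV := by
  rw [mem_swapRing, swapX_negEmb]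
  exact posEmb_mem_laurentRing hp

/-- Used with `V = ⊤`, where membership carries no arithmetic information and only says that the
exponents of `x` are bounded below uniformly in `t`. -/
theorem exists_lower_bound {V : Subring (PowerSeries ℝ[X])} {hV : PowerSeries.C Polynomial.X ∈ V}
    {f : PowerSeries ℝ[T;T⁻¹]} (hf : f ∈ laurentRing V hV) :
    ∃ N : ℕ, ∀ i : ℤ, i < -N → laurentCoeff i f = 0 := by
  obtain ⟨N, p, -, h⟩ := hf
  refine ⟨N, fun i hi => ?_⟩
  have h1 := laurentCoeff_posEmb_of_neg p (i := i + N) (by omega)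
  rwa [← h, laurentCoeff_monomialX_mul, add_sub_cancel_right] at h1

theorem exists_upper_bound {V : Subring (PowerSeries ℝ[X])} {hV : PowerSeries.C Polynomial.X ∈ V}
    {f : PowerSeries ℝ[T;T⁻¹]} (hf : f ∈ swapRing V hV) :
    ∃ N : ℕ, ∀ i : ℤ, N < i → laurentCoeff i f = 0 := by
  obtain ⟨N, hN⟩ := exists_lower_bound (mem_swapRing.mp hf)
  refine ⟨N, fun i hi => ?_⟩
  have := hN (-i) (by omega)
  rwa [laurentCoeff_swapX, neg_neg] at this

theorem laurentCoeff_mem {hV : PowerSeries.C Polynomial.X ∈ expansionRing k {0}}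
    {f : PowerSeries ℝ[T;T⁻¹]} (hf : f ∈ laurentRing (expansionRing k {0}) hV) (i : ℤ) :
    ofRealSeriesHom (laurentCoeff i f) ∈ k := by
  obtain ⟨N, p, hp, h⟩ := hf
  have h1 := mem_expansionRing_zero.mp hp (i + N)
  rwa [← h, laurentCoeff_monomialX_mul, add_sub_cancel_right] at h1

theorem mem_laurentRing_of_laurentCoeff_mem
    {hV : PowerSeries.C Polynomial.X ∈ expansionRing k {0}} {f : PowerSeries ℝ[T;T⁻¹]}
    (N : ℕ) (hN : ∀ i : ℤ, i < -N → laurentCoeff i f = 0)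
    (hf : ∀ i, ofRealSeriesHom (laurentCoeff i f) ∈ k) :
    f ∈ laurentRing (expansionRing k {0}) hV := by
  obtain ⟨p, hp⟩ := exists_posEmb_eq (f := monomialX N * f) fun i hi => by
    rw [laurentCoeff_monomialX_mul, hN _ (by omega)]
  refine ⟨N, p, mem_expansionRing_zero.mpr fun i => ?_, hp.symm⟩
  rw [hp, laurentCoeff_monomialX_mul]
  exact hf _

/-- A power of `x` turns `f` into a power series in `x`; division by it then takes place among power
series over `k`. -/
theorem mem_laurentRing_of_mul_mem {hV : PowerSeries.C Polynomial.X ∈ expansionRing k {0}}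
    {f : PowerSeries ℝ[T;T⁻¹]} {g : PowerSeries ℝ[X]}
    (hf : f ∈ laurentRing (expansionRing k {0}) hV) (hf0 : f ≠ 0)
    (hfg : f * posEmb g ∈ laurentRing (expansionRing k {0}) hV) : g ∈ expansionRing k {0} := by
  obtain ⟨N, p, hp, h1⟩ := hf
  have h2 : p ≠ 0 := by
    rintro rfl
    rw [map_zero] at h1
    have := congrArg (monomialX (-N : ℤ) * ·) h1
    simp only [← mul_assoc, monomialX_neg_mul, one_mul, mul_zero] at this
    exact hf0 this
  have h3 : p * g ∈ expansionRing k {0} := by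
    rw [mem_expansionRing_zero]
    intro i
    rw [map_mul, ← h1, mul_assoc, laurentCoeff_monomialX_mul]
    exact laurentCoeff_mem hfg _
  rw [mem_expansionRing] at hp h3 ⊢
  intro α hα
  rw [Set.mem_singleton_iff] at hα
  subst hα
  have h4 := h3 0 rfl
  rw [map_mul] at h4
  exact mem_seriesOver_of_mul_mem (hp 0 rfl)
    ((map_ne_zero_iff _ expand_zero_injective).mpr h2) h4

end Expansion

/-! ### Algebraicity of the generators -/

section Algebraicity

/-- A monic divisor of a monic polynomial over `F` has integral coefficients. Normalizing `p` to be
monic loses its leading coefficient, which `p(0) = 1` recovers: the constant term of the monic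
version is its inverse. -/
theorem isIntegral_coeff_of_mul {F K : Type*} [Field F] [Field K] [Algebra F K] {p q : K[X]}
    (hpq : ∀ n, (p * q).coeff n ∈ (algebraMap F K).range) (hp : p.coeff 0 = 1) (hq : q ≠ 0)
    (n : ℕ) : IsIntegral F (p.coeff n) := by
  obtain ⟨f, hf⟩ : ∃ f : F[X], f.map (algebraMap F K) = p * q := by
    rw [← Polynomial.mem_lifts, Polynomial.lifts_iff_coeff_lifts]
    exact hpq
  have hp0 : p ≠ 0 := by
    rintro rfl
    rw [Polynomial.coeff_zero] at hp
    exact zero_ne_one hp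
  have hf0 : f ≠ 0 := by
    rintro rfl
    rw [Polynomial.map_zero] at hf
    exact mul_ne_zero hp0 hq hf.symm
  have h1 := integralClosure.mem_lifts_of_monic_of_dvd_map K
    (Polynomial.monic_mul_leadingCoeff_inv hf0) (Polynomial.monic_mul_leadingCoeff_inv hp0) (by
      rw [Polynomial.map_mul, hf, Polynomial.map_C]
      refine mul_dvd_mul (dvd_mul_right p q) ?_
      refine (Polynomial.isUnit_C.mpr ?_).dvd
      exact (inv_ne_zero (Polynomial.leadingCoeff_ne_zero.mpr hp0)).isUnit)
  rw [Polynomial.lifts_iff_coeff_lifts] at h1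
  have h2 : ∀ m, IsIntegral F (p.coeff m * p.leadingCoeff⁻¹) := fun m => by
    obtain ⟨c, hc⟩ := h1 m
    rw [Polynomial.coeff_mul_C] at hc
    rw [← hc]
    exact c.2
  have h3 := h2 0
  rw [hp, one_mul] at h3
  have h4 := (h2 n).mul h3.inv
  rwa [inv_inv, inv_mul_cancel_right₀ (Polynomial.leadingCoeff_ne_zero.mpr hp0)] at h4

theorem C_X_mem_expansionRing_zero (k : Subfield SeriesT) :
    PowerSeries.C Polynomial.X ∈ expansionRing k {0} :=
  C_X_mem_expansionRing fun α hα => by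
    rw [Set.mem_singleton_iff.mp hα, map_zero]
    exact zero_mem _

theorem exists_polynomial_coe_eq {f : PowerSeries ℝ[X]} {N : ℕ}
    (hN : ∀ i : ℤ, N < i → laurentCoeff i (posEmb f) = 0) :
    ∃ p : SeriesT[X], (p : PowerSeries SeriesT) = expand 0 f := by
  refine ⟨PowerSeries.trunc (N + 1) (expand 0 f), ?_⟩
  ext n : 1
  rw [Polynomial.coeff_coe, PowerSeries.coeff_trunc]
  split_ifs with h
  · rfl
  · rw [coeff_expand_zero, hN _ (by omega), map_zero]

theorem eq_sum_of_bounded {f : PowerSeries ℝ[X]} {N : ℕ}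
    (hN : ∀ i : ℤ, N < i → laurentCoeff i (posEmb f) = 0) :
    f = ∑ i ∈ Finset.range (N + 1), PowerSeries.map Polynomial.C (laurentCoeff i (posEmb f)) *
      PowerSeries.C Polynomial.X ^ i := by
  refine posEmb_injective (ext_laurentCoeff fun l => ?_)
  simp only [map_sum, map_mul, map_pow, ← constEmb_eq_posEmb, laurentCoeff_constEmb_mul]
  have h1 : ∀ i : ℕ, laurentCoeff l (posEmb (PowerSeries.C (Polynomial.X : ℝ[X])) ^ i) =
      if l = i then 1 else 0 := fun i => by
    rw [← map_pow, ← map_pow, ← monomialX_natCast, ← mul_one (monomialX _),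
      laurentCoeff_monomialX_mul, ← map_one constEmb, laurentCoeff_constEmb]
    simp only [sub_eq_zero]
  simp only [h1, mul_ite, mul_one, mul_zero]
  rcases lt_or_ge l 0 with hl | hl
  · rw [laurentCoeff_posEmb_of_neg _ hl, Finset.sum_eq_zero]
    intro i _
    rw [if_neg (by omega)]
  · lift l to ℕ using hl
    simp only [Nat.cast_inj, Finset.sum_ite_eq, Finset.mem_range]
    split_ifs with h
    · rfl
    · exact hN _ (by omega)

/-- The degree bound is essential: without it an expansion coefficient at `α ≠ 0` would involve
infinitely many coefficients at `0`. -/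
theorem mem_expansionRing_of_bounded {k : Subfield SeriesT} {Z : Set ℂ}
    (hZ : ∀ α ∈ Z, (HahnSeries.C α : SeriesT) ∈ k) {f : PowerSeries ℝ[X]} {N : ℕ}
    (hN : ∀ i : ℤ, N < i → laurentCoeff i (posEmb f) = 0)
    (hf : ∀ i : ℤ, ofRealSeriesHom (laurentCoeff i (posEmb f)) ∈ k) : f ∈ expansionRing k Z := by
  rw [eq_sum_of_bounded hN]
  exact sum_mem fun i _ => mul_mem (map_C_mem_expansionRing (hf i))
    (pow_mem (C_X_mem_expansionRing hZ) _)

/-- In `P = E/(D Q(x̄))` the inverse of `Q(x̄)` is again a series in `x̄`, so the exponents of `P`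
are bounded above as those of `E` are. -/
theorem exists_degree_bound {E : PowerSeries ℝ[T;T⁻¹]} {D : PowerSeries ℝ} {P Q : PowerSeries ℝ[X]}
    (h : E = constEmb D * posEmb P * negEmb Q) (hE : E ∈ swapRing ⊤ (Subring.mem_top _))
    (hD : PowerSeries.constantCoeff D = 1) (hQ : PowerSeries.constantCoeff Q = 1) :
    ∃ N : ℕ, ∀ i : ℤ, N < i → laurentCoeff i (posEmb P) = 0 := by
  obtain ⟨D', hD'⟩ := (isUnit_of_constantCoeff_one hD).exists_right_inv
  obtain ⟨W, hW⟩ := (isUnit_of_constantCoeff_one hQ).exists_right_inv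
  have hD1 : constEmb D * constEmb D' = 1 := by rw [← map_mul, hD', map_one]
  have hW1 : negEmb Q * negEmb W = 1 := by rw [← map_mul, hW, map_one]
  have h1 : posEmb P = E * (constEmb D' * negEmb W) := by
    rw [h]
    linear_combination (-posEmb P) * hD1 - posEmb P * constEmb D * constEmb D' * hW1
  refine exists_upper_bound (V := ⊤) (hV := Subring.mem_top _) ?_
  rw [h1, constEmb_eq_negEmb]
  exact mul_mem hE (mul_mem (negEmb_mem_swapRing (Subring.mem_top _))
    (negEmb_mem_swapRing (Subring.mem_top _)))

/-- After multiplication by `x^N`, the series `Q(x̄)` becomes a polynomial in `x`, and `P` becomes a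
factor, with constant term `1`, of the polynomial `x^N E` over `ℚ(t)`. -/
theorem isIntegral_laurentCoeff {E : PowerSeries ℝ[T;T⁻¹]} {D : PowerSeries ℝ}
    {P Q : PowerSeries ℝ[X]} (h : E = constEmb D * posEmb P * negEmb Q)
    (hE : ∀ i, ofRealSeriesHom (laurentCoeff i E) ∈ QT)
    (hD : PowerSeries.constantCoeff D = 1)
    (hP : PowerSeries.map (Polynomial.evalRingHom 0) P = 1)
    (hQ : PowerSeries.constantCoeff Q = 1) {N : ℕ}
    (hPN : ∀ i : ℤ, N < i → laurentCoeff i (posEmb P) = 0)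
    (hQN : ∀ i : ℤ, N < i → laurentCoeff i (posEmb Q) = 0) (i : ℤ) :
    IsIntegral QT (ofRealSeriesHom (laurentCoeff i (posEmb P))) := by
  rcases lt_or_ge i 0 with hi | hi
  · rw [laurentCoeff_posEmb_of_neg _ hi, map_zero]
    exact isIntegral_zero
  lift i to ℕ using hi
  obtain ⟨q, hq⟩ := exists_posEmb_eq (f := monomialX N * negEmb Q) fun l hl => by
    rw [laurentCoeff_monomialX_mul, ← swapX_posEmb, laurentCoeff_swapX, hQN _ (by omega)]
  obtain ⟨p', hp'⟩ := exists_polynomial_coe_eq hPN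
  obtain ⟨q', hq'⟩ := exists_polynomial_coe_eq (f := q) (N := N) fun l hl => by
    rw [hq, laurentCoeff_monomialX_mul, laurentCoeff_negEmb_of_pos _ (by omega)]
  have h1 : posEmb (P * (PowerSeries.map Polynomial.C D * q)) = monomialX N * E := by
    rw [map_mul, map_mul, ← constEmb_eq_posEmb, hq, h]
    ring
  have h2 : ((p' * (Polynomial.C (ofRealSeriesHom D) * q') : SeriesT[X]) : PowerSeries SeriesT) =
      expand 0 (P * (PowerSeries.map Polynomial.C D * q)) := by
    rw [Polynomial.coe_mul, Polynomial.coe_mul, hp', hq', Polynomial.coe_C, map_mul, map_mul,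
      expand_map_C]
  have h3 := isIntegral_coeff_of_mul (F := QT) (p := p')
    (q := Polynomial.C (ofRealSeriesHom D) * q') (fun n => ?_) ?_ ?_ i
  · rwa [← Polynomial.coeff_coe, hp', coeff_expand_zero] at h3
  · rw [← Polynomial.coeff_coe, h2, coeff_expand_zero, h1, laurentCoeff_monomialX_mul]
    exact ⟨⟨_, hE _⟩, rfl⟩
  · rw [← Polynomial.coeff_coe, hp', coeff_expand_zero, Nat.cast_zero, laurentCoeff_zero_posEmb, hP,
      map_one]
  · have hD0 : D ≠ 0 := by
      rintro rfl
      rw [map_zero] at hD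
      exact zero_ne_one hD
    have hq0 : q ≠ 0 := by
      rintro rfl
      rw [map_zero] at hq
      have h4 := congrArg (monomialX (-N : ℤ) * ·) hq
      simp only [← mul_assoc, monomialX_neg_mul, one_mul, mul_zero] at h4
      rw [negEmb_injective (h4.symm.trans (map_zero negEmb).symm), map_zero] at hQ
      exact zero_ne_one hQ
    refine mul_ne_zero ?_ ?_
    · rw [Ne, Polynomial.C_eq_zero, map_eq_zero_iff _ ofRealSeriesHom_injective]
      exact hD0
    · rintro rfl
      rw [Polynomial.coe_zero] at hq'
      exact hq0 (expand_zero_injective (hq'.symm.trans (map_zero _).symm))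

theorem tT_mem_QT : tT ∈ QT := IntermediateField.subset_adjoin _ _ rfl

theorem deltaSeries_mem_laurentRing (A : Finset (ℤ × ℤ)) {k : Subfield SeriesT} (ht : tT ∈ k) :
    deltaSeries A ∈ laurentRing (expansionRing k {0}) (C_X_mem_expansionRing_zero k) :=
  deltaSeries_mem (fun i => monomialX_mem_laurentRing i)
    (X_mem_laurentRing (X_mem_expansionRing ht)) A

theorem deltaSeries_mem_swapRing (A : Finset (ℤ × ℤ)) :
    deltaSeries A ∈ swapRing ⊤ (Subring.mem_top _) :=
  deltaSeries_mem (fun i => monomialX_mem_swapRing i) (X_mem_swapRing (Subring.mem_top _)) A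

theorem swapX_deltaSeries_mem_swapRing (A : Finset (ℤ × ℤ)) :
    swapX (deltaSeries A) ∈ swapRing ⊤ (Subring.mem_top _) := by
  rw [mem_swapRing, swapX_swapX]
  exact laurentRing_mono le_top (deltaSeries_mem_laurentRing A (k := QT.toSubfield) tT_mem_QT)

variable {A : Finset (ℤ × ℤ)} {F : Triple}

/-- The substitution `x ↦ x⁻¹` exchanges `Δ` and `Δ̄`, so results on the first transfer to the
second. -/
theorem IsCanonicalFactorization.swapX_deltaSeries_eq (hF : IsCanonicalFactorization A F) :
    swapX (deltaSeries A) = constEmb F.D * posEmb F.DeltaBar * negEmb F.Delta := by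
  rw [hF.deltaSeries_eq, map_mul, map_mul, swapX_constEmb, swapX_posEmb, swapX_negEmb]
  ring

theorem IsCanonicalFactorization.exists_bound (hF : IsCanonicalFactorization A F) :
    ∃ N : ℕ, (∀ i : ℤ, N < i → laurentCoeff i (posEmb F.Delta) = 0) ∧
      ∀ i : ℤ, N < i → laurentCoeff i (posEmb F.DeltaBar) = 0 := by
  obtain ⟨N, hN⟩ := exists_degree_bound hF.deltaSeries_eq (deltaSeries_mem_swapRing A)
    hF.D_zero hF.DeltaBar_t_zero
  obtain ⟨M, hM⟩ := exists_degree_bound hF.swapX_deltaSeries_eq (swapX_deltaSeries_mem_swapRing A)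
    hF.D_zero hF.Delta_t_zero
  exact ⟨max N M, fun i hi => hN i (lt_of_le_of_lt (by simp) hi),
    fun i hi => hM i (lt_of_le_of_lt (by simp) hi)⟩

theorem ofRealSeriesHom_laurentCoeff_deltaSeries_mem (A : Finset (ℤ × ℤ)) (i : ℤ) :
    ofRealSeriesHom (laurentCoeff i (deltaSeries A)) ∈ QT :=
  laurentCoeff_mem (deltaSeries_mem_laurentRing A (k := QT.toSubfield) tT_mem_QT) i

theorem IsCanonicalFactorization.isIntegral_Delta (hF : IsCanonicalFactorization A F) (i : ℤ) :
    IsIntegral QT (ofRealSeriesHom (laurentCoeff i (posEmb F.Delta))) := by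
  obtain ⟨N, hN, hM⟩ := hF.exists_bound
  exact isIntegral_laurentCoeff hF.deltaSeries_eq (ofRealSeriesHom_laurentCoeff_deltaSeries_mem A)
    hF.D_zero hF.Delta_x_zero hF.DeltaBar_t_zero hN hM i

theorem IsCanonicalFactorization.isIntegral_DeltaBar (hF : IsCanonicalFactorization A F) (i : ℤ) :
    IsIntegral QT (ofRealSeriesHom (laurentCoeff i (posEmb F.DeltaBar))) := by
  obtain ⟨N, hN, hM⟩ := hF.exists_bound
  refine isIntegral_laurentCoeff hF.swapX_deltaSeries_eq (fun i => ?_)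
    hF.D_zero hF.DeltaBar_x_zero hF.Delta_t_zero hM hN i
  rw [laurentCoeff_swapX]
  exact ofRealSeriesHom_laurentCoeff_deltaSeries_mem A _

theorem mem_algebraicClosure_toSubfield {a : SeriesT} :
    a ∈ (algebraicClosure QT SeriesT).toSubfield ↔ IsIntegral QT a :=
  (mem_algebraicClosure_iff (F := QT) (E := SeriesT)).trans isAlgebraic_iff_isIntegral

/-- Compare a nonzero coefficient of `x^i` in `ΔΔ̄`, which is algebraic, with that of `δ = D ΔΔ̄`,
which is in `ℚ(t)`. -/
theorem IsCanonicalFactorization.isIntegral_D (hF : IsCanonicalFactorization A F) :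
    IsIntegral QT (ofRealSeriesHom F.D) := by
  obtain ⟨N, hN, hM⟩ := hF.exists_bound
  set k := (algebraicClosure QT SeriesT).toSubfield
  have h1 : posEmb F.Delta * negEmb F.DeltaBar ∈
      laurentRing (expansionRing k {0}) (C_X_mem_expansionRing_zero k) := by
    refine mul_mem (posEmb_mem_laurentRing (mem_expansionRing_zero.mpr fun i =>
      mem_algebraicClosure_toSubfield.mpr (hF.isIntegral_Delta i)))
      (mem_laurentRing_of_laurentCoeff_mem N (fun i hi => ?_) fun i => ?_)
    · rw [← swapX_posEmb, laurentCoeff_swapX, hM _ (by omega)]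
    · rw [← swapX_posEmb, laurentCoeff_swapX]
      exact mem_algebraicClosure_toSubfield.mpr (hF.isIntegral_DeltaBar _)
  have h2 : posEmb F.Delta * negEmb F.DeltaBar ≠ 0 := by
    intro h0
    have h3 := hF.deltaSeries_eq
    rw [mul_assoc, h0, mul_zero] at h3
    have h4 := constantCoeff_deltaSeries A
    rw [h3, map_zero] at h4
    exact zero_ne_one h4
  obtain ⟨i, hi⟩ : ∃ i, laurentCoeff i (posEmb F.Delta * negEmb F.DeltaBar) ≠ 0 := by
    by_contra! hall
    exact h2 (ext_laurentCoeff fun i => by rw [hall, map_zero])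
  have h3 := ofRealSeriesHom_laurentCoeff_deltaSeries_mem A i
  rw [hF.deltaSeries_eq, mul_assoc, laurentCoeff_constEmb_mul, map_mul] at h3
  have h4 : IsIntegral QT (ofRealSeriesHom F.D *
      ofRealSeriesHom (laurentCoeff i (posEmb F.Delta * negEmb F.DeltaBar))) :=
    isIntegral_algebraMap (R := QT) (x := ⟨_, h3⟩)
  have h5 := (mem_algebraicClosure_toSubfield.mp (laurentCoeff_mem h1 i)).inv
  have h6 := h4.mul h5
  rwa [mul_inv_cancel_right₀] at h6
  rwa [Ne, map_eq_zero_iff _ ofRealSeriesHom_injective]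

theorem IsCanonicalFactorization.isIntegral_sqrt_D (hF : IsCanonicalFactorization A F) :
    IsIntegral QT (ofRealSeries (sqrtSeries F.D)) := by
  refine IsIntegral.of_pow two_pos ?_
  rw [← ofRealSeriesHom_apply, ← map_pow, sqrtSeries_sq hF.D_zero]
  exact hF.isIntegral_D

/-- A lower bound for the abscissae of the steps, up to sign. -/
def stepBound (A : Finset (ℤ × ℤ)) : ℕ := A.sup fun s => s.1.natAbs

theorem neg_stepBound_le {s : ℤ × ℤ} (hs : s ∈ A) : 0 ≤ s.1 + stepBound A := by
  have : s.1.natAbs ≤ stepBound A := Finset.le_sup (f := fun s : ℤ × ℤ => s.1.natAbs) hs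
  omega

/-- The polynomial `x^M A₁(x)`, where `M` is `stepBound A`. -/
def risePoly (R : Type*) [CommRing R] (A : Finset (ℤ × ℤ)) : R[X] :=
  ∑ s ∈ A with s.2 = 1, Polynomial.X ^ (s.1 + stepBound A).toNat

theorem map_risePoly {R S : Type*} [CommRing R] [CommRing S] (φ : R →+* S) (A : Finset (ℤ × ℤ)) :
    (risePoly R A).map φ = risePoly S A := by
  simp [risePoly, Polynomial.map_sum]

theorem toLaurent_risePoly (A : Finset (ℤ × ℤ)) :
    Polynomial.toLaurent (risePoly ℝ A) = LaurentPolynomial.T (stepBound A) * stepPoly A 1 := by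
  rw [risePoly, stepPoly, map_sum, Finset.mul_sum]
  refine Finset.sum_congr rfl fun s hs => ?_
  rw [Polynomial.toLaurent_X_pow,
    Int.toNat_of_nonneg (neg_stepBound_le (Finset.mem_filter.mp hs).1),
    add_comm, LaurentPolynomial.T_add]

theorem eval_risePoly (A : Finset (ℤ × ℤ)) {α : ℂ} (hα : α ≠ 0) :
    (risePoly ℂ A).eval α = α ^ stepBound A * ∑ s ∈ A with s.2 = 1, α ^ s.1 := by
  rw [risePoly, Polynomial.eval_finsetSum, Finset.mul_sum]
  refine Finset.sum_congr rfl fun s hs => ?_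
  rw [Polynomial.eval_pow, Polynomial.eval_X, ← zpow_natCast,
    Int.toNat_of_nonneg (neg_stepBound_le (Finset.mem_filter.mp hs).1), zpow_add₀ hα, zpow_natCast,
    mul_comm]

theorem A₁_eq_zero_iff (A : Finset (ℤ × ℤ)) : A₁ A = 0 ↔ stepPoly A 1 = 0 := by
  rw [A₁, ← toSeriesXT_C_stepPoly, map_eq_zero_iff _ toSeriesXT_injective,
    map_eq_zero_iff _ PowerSeries.C_injective]

theorem risePoly_ne_zero {R : Type*} [CommRing R] [CharZero R] (hA : A₁ A ≠ 0) :
    risePoly R A ≠ 0 := by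
  intro h
  have h1 := congrArg (Polynomial.eval 1) h
  rw [risePoly, Polynomial.eval_finsetSum] at h1
  simp only [Polynomial.eval_pow, Polynomial.eval_X, one_pow, Finset.sum_const, nsmul_eq_mul,
    mul_one, Polynomial.eval_zero, Nat.cast_eq_zero, Finset.card_eq_zero] at h1
  refine hA ?_
  rw [A₁, h1, Finset.sum_empty]

theorem isRoot_of_mem_rootsA₁ {α : ℂ} (hα : α ∈ rootsA₁ A) : (risePoly ℂ A).IsRoot α := by
  rw [Polynomial.IsRoot, eval_risePoly A hα.2.1, hα.2.2, mul_zero]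

theorem rootsA₁_finite (A : Finset (ℤ × ℤ)) : (rootsA₁ A).Finite := by
  by_cases h : A₁ A = 0
  · have : rootsA₁ A = ∅ := Set.eq_empty_of_forall_notMem fun α hα => hα.1 h
    rw [this]
    exact Set.finite_empty
  · exact (Polynomial.finite_setOfPred_isRoot (risePoly_ne_zero h)).subset
      fun α hα => isRoot_of_mem_rootsA₁ hα

theorem isIntegral_root {α : ℂ} (hα : α ∈ rootsA₁ A) :
    IsIntegral QT (HahnSeries.C α : SeriesT) := by
  have : CharZero QT := algebraRat.charZero QT
  rw [← isAlgebraic_iff_isIntegral]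
  refine ⟨risePoly QT A, risePoly_ne_zero hα.1, ?_⟩
  rw [Polynomial.aeval_def, ← Polynomial.eval_map, map_risePoly,
    ← map_risePoly (HahnSeries.C : ℂ →+* SeriesT), Polynomial.eval_map, Polynomial.eval₂_at_apply,
    isRoot_of_mem_rootsA₁ hα, map_zero]

/-- Its square `Δ(α;t)` is the value at an algebraic number of a polynomial in `x` with algebraic
coefficients. -/
theorem IsCanonicalFactorization.isIntegral_sqrt_evalAt (hF : IsCanonicalFactorization A F)
    {α : ℂ} (hα : α ∈ rootsA₁ A) :
    IsIntegral QT ((sqrtSeries (evalAt α F.Delta) : PowerSeries ℂ) : LaurentSeries ℂ) := by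
  refine IsIntegral.of_pow two_pos ?_
  have hc : PowerSeries.constantCoeff (evalAt α F.Delta) = 1 :=
    constantCoeff_map_one _ hF.Delta_t_zero
  rw [← map_pow, sqrtSeries_sq hc, ← constantCoeff_expand]
  obtain ⟨N, hN, -⟩ := hF.exists_bound
  have h1 : F.Delta ∈ expansionRing (algebraicClosure QT SeriesT).toSubfield {α} := by
    refine mem_expansionRing_of_bounded (fun β hβ => ?_) hN fun i =>
      mem_algebraicClosure_toSubfield.mpr (hF.isIntegral_Delta i)
    rw [Set.mem_singleton_iff.mp hβ]
    exact mem_algebraicClosure_toSubfield.mpr (isIntegral_root hα)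
  have h2 := mem_seriesOver.mp (mem_expansionRing.mp h1 α rfl) 0
  rw [PowerSeries.coeff_zero_eq_constantCoeff_apply] at h2
  exact mem_algebraicClosure_toSubfield.mp h2

theorem xCoeff_eq_laurentCoeff (k : ℕ) (f : PowerSeries ℝ[X]) :
    xCoeff k f = laurentCoeff k (posEmb f) := (laurentCoeff_posEmb_natCast f k).symm

theorem finite_range_xCoeff {f : PowerSeries ℝ[X]} {N : ℕ}
    (hN : ∀ i : ℤ, N < i → laurentCoeff i (posEmb f) = 0) :
    (Set.range fun k => ofRealSeries (xCoeff k f)).Finite := by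
  refine (((Finset.range (N + 1)).finite_toSet.image
    fun k => ofRealSeries (xCoeff k f)).insert 0).subset ?_
  rintro _ ⟨k, rfl⟩
  by_cases hk : k < N + 1
  · exact Or.inr ⟨k, Finset.mem_coe.mpr (Finset.mem_range.mpr hk), rfl⟩
  · refine Or.inl ?_
    change ofRealSeries (xCoeff k f) = 0
    rw [xCoeff_eq_laurentCoeff, hN _ (by omega), ← ofRealSeriesHom_apply, map_zero]

theorem IsCanonicalFactorization.finiteDimensional_QA (hF : IsCanonicalFactorization A F) :
    FiniteDimensional QT (QA A F) := by
  obtain ⟨N, hN, hM⟩ := hF.exists_bound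
  have hfin := (((((Set.finite_singleton (ofRealSeries (sqrtSeries F.D))).union
    (finite_range_xCoeff hN)).union (finite_range_xCoeff hM)).union
    ((rootsA₁_finite A).image fun α : ℂ => (HahnSeries.C α : SeriesT))).union
    ((rootsA₁_finite A).image fun α : ℂ =>
      ((sqrtSeries (evalAt α F.Delta) : PowerSeries ℂ) : LaurentSeries ℂ)))
  have := hfin.to_subtype
  refine IntermediateField.finiteDimensional_adjoin fun a ha => ?_
  rcases ha with (((rfl | ⟨k, rfl⟩) | ⟨k, rfl⟩) | ⟨α, hα, rfl⟩) | ⟨α, hα, rfl⟩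
  · exact hF.isIntegral_sqrt_D
  · change IsIntegral QT (ofRealSeries (xCoeff k F.Delta))
    rw [xCoeff_eq_laurentCoeff]
    exact hF.isIntegral_Delta k
  · change IsIntegral QT (ofRealSeries (xCoeff k F.DeltaBar))
    rw [xCoeff_eq_laurentCoeff]
    exact hF.isIntegral_DeltaBar k
  · exact isIntegral_root hα
  · exact hF.isIntegral_sqrt_evalAt hα

end Algebraicity

/-! ### Positive and negative parts of the generating functions -/

section Parts

theorem laurentToRatFunc_eq_finsum (A : Finset (ℤ × ℤ)) (j : ℤ) (n : ℕ) {f : ℝ[T;T⁻¹]} {s : Set ℤ}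
    (hf : ∀ i, f.coeff i = s.indicator (fun i => (count A i j n : ℝ)) i) :
    laurentToRatFunc f = ∑ᶠ i ∈ s, (count A i j n : RatFunc ℂ) * RatFunc.X ^ i := by
  have h1 : ∀ i, s.indicator (fun i => (count A i j n : RatFunc ℂ) * RatFunc.X ^ i) i =
      RatFunc.C (f.coeff i : ℂ) * RatFunc.X ^ i := fun i => by
    rw [hf]
    by_cases hi : i ∈ s <;> simp [hi]
  rw [finsum_mem_def, finsum_congr h1, finsum_eq_sum_of_support_subset (s := f.coeff.support)]
  · conv_lhs => rw [← AddMonoidAlgebra.sum_coeff_single f, Finsupp.sum, map_sum]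
    refine Finset.sum_congr rfl fun i _ => ?_
    rw [LaurentPolynomial.single_eq_C_mul_T, map_mul, laurentToRatFunc_C, laurentToRatFunc_T]
  · intro i hi
    rw [Finset.mem_coe, Finsupp.mem_support_iff]
    rintro h0
    simp [h0] at hi

theorem toSeriesXT_eq_mk_finsum (A : Finset (ℤ × ℤ)) (j : ℤ) {f : PowerSeries ℝ[T;T⁻¹]} {s : Set ℤ}
    (hf : ∀ i n, PowerSeries.coeff n (laurentCoeff i f) =
      s.indicator (fun i => (count A i j n : ℝ)) i) :
    toSeriesXT f = ((PowerSeries.mk fun n => ∑ᶠ i ∈ s, (count A i j n : RatFunc ℂ) * RatFunc.X ^ i :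
      PowerSeries (RatFunc ℂ)) : LaurentSeries (RatFunc ℂ)) := by
  rw [toSeriesXT, RingHom.comp_apply]
  congr 1
  ext n : 1
  rw [PowerSeries.coeff_map, PowerSeries.coeff_mk]
  refine laurentToRatFunc_eq_finsum A j n fun i => ?_
  rw [← coeff_laurentCoeff, hf]

/-- The factor `x⁻¹` records that the exponents of `S_j⁻` are strictly negative; the interpolation
depends on this strictness. -/
theorem exists_walkSeries_split (A : Finset (ℤ × ℤ)) (j : ℤ) :
    ∃ p m : PowerSeries ℝ[X], walkSeries A j = posEmb p + monomialX (-1) * negEmb m ∧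
      toSeriesXT (posEmb p) = SPlus A j ∧ toSeriesXT (monomialX (-1) * negEmb m) = SMinus A j := by
  set p : PowerSeries ℝ[X] := PowerSeries.mk fun n => LaurentPolynomial.trunc (walkPoly A j n)
  have hp : ∀ i n, PowerSeries.coeff n (laurentCoeff i (posEmb p)) =
      {i : ℤ | 0 ≤ i}.indicator (fun i => (count A i j n : ℝ)) i := fun i n => by
    rcases lt_or_ge i 0 with hi | hi
    · rw [laurentCoeff_posEmb_of_neg _ hi, Set.indicator_of_notMem (by simpa using hi), map_zero]
    · rw [Set.indicator_of_mem (by simpa using hi)]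
      lift i to ℕ using hi
      rw [laurentCoeff_posEmb_natCast, PowerSeries.coeff_mk, PowerSeries.coeff_mk, trunc_coeff,
        walkPoly_coeff]
  have hm : ∀ i n, PowerSeries.coeff n (laurentCoeff i (walkSeries A j - posEmb p)) =
      {i : ℤ | i < 0}.indicator (fun i => (count A i j n : ℝ)) i := fun i n => by
    rw [map_sub, map_sub, hp, coeff_laurentCoeff_walkSeries]
    rcases lt_or_ge i 0 with hi | hi
    · rw [Set.indicator_of_notMem (by simpa using hi), Set.indicator_of_mem (by simpa using hi),
        sub_zero]
    · rw [Set.indicator_of_mem (by simpa using hi), Set.indicator_of_notMem (by simpa using hi),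
        sub_self]
  obtain ⟨m, hm'⟩ := exists_negEmb_eq (f := monomialX 1 * (walkSeries A j - posEmb p))
    fun i hi => by
      ext n
      rw [laurentCoeff_monomialX_mul, hm, Set.indicator_of_notMem (by simp; omega), map_zero]
  have hm1 : monomialX (-1) * negEmb m = walkSeries A j - posEmb p := by
    rw [hm', ← mul_assoc, monomialX_neg_mul, one_mul]
  refine ⟨p, m, by rw [hm1]; ring, toSeriesXT_eq_mk_finsum A j hp, ?_⟩
  rw [hm1]
  exact toSeriesXT_eq_mk_finsum A j hm

theorem S_eq_ofRealSeriesHom (A : Finset (ℤ × ℤ)) (i j : ℤ) :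
    S A i j = ofRealSeriesHom (laurentCoeff i (walkSeries A j)) := by
  rw [S, ofRealSeriesHom, RingHom.comp_apply]
  congr 1
  ext n
  rw [PowerSeries.coeff_mk, PowerSeries.coeff_map, coeff_laurentCoeff_walkSeries]
  simp

end Parts

/-! ### The Laurent polynomials `g_j` -/

section Interpolation

theorem exists_polynomial_expand {f : PowerSeries ℝ[X]} {N : ℕ}
    (hN : ∀ i : ℤ, N < i → laurentCoeff i (posEmb f) = 0) :
    ∃ p : SeriesT[X], (∀ α : ℂ, ((Polynomial.taylor (HahnSeries.C α) p : SeriesT[X]) :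
        PowerSeries SeriesT) = expand α f) ∧
      ∀ i : ℕ, p.coeff i = ofRealSeriesHom (laurentCoeff i (posEmb f)) := by
  have h1 : ∀ α : ℂ, ((Polynomial.taylor (HahnSeries.C α)
      (∑ i ∈ Finset.range (N + 1), Polynomial.C (ofRealSeriesHom (laurentCoeff i (posEmb f))) *
        Polynomial.X ^ i : SeriesT[X]) : SeriesT[X]) : PowerSeries SeriesT) = expand α f := by
    intro α
    conv_rhs => rw [eq_sum_of_bounded hN]
    rw [map_sum, map_sum, ← Polynomial.coeToPowerSeries.ringHom_apply, map_sum]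
    refine Finset.sum_congr rfl fun i _ => ?_
    rw [Polynomial.taylor_mul, Polynomial.taylor_C, Polynomial.taylor_pow, map_mul, map_mul,
      map_pow, map_pow, expand_map_C, expand_C, Polynomial.map_X,
      Polynomial.coeToPowerSeries.ringHom_apply, Polynomial.coeToPowerSeries.ringHom_apply,
      Polynomial.coe_C]
  refine ⟨_, h1, fun i => ?_⟩
  have h2 := h1 0
  rw [map_zero, Polynomial.taylor_zero] at h2
  rw [← Polynomial.coeff_coe, h2, coeff_expand_zero]

theorem posEmb_C_risePoly (A : Finset (ℤ × ℤ)) :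
    posEmb (PowerSeries.C (risePoly ℝ A)) =
      monomialX (stepBound A) * PowerSeries.C (stepPoly A 1) := by
  rw [posEmb, PowerSeries.map_C, toLaurent_risePoly, map_mul, monomialX]

theorem twoTA₁_pow_eq (A : Finset (ℤ × ℤ)) (j : ℕ) :
    monomialX ((j * stepBound A : ℕ) : ℤ) * twoTA₁ A ^ j =
      posEmb ((2 * PowerSeries.X) ^ j * PowerSeries.C (risePoly ℝ A ^ j)) := by
  have h1 : posEmb (2 * PowerSeries.X : PowerSeries ℝ[X]) = 2 * PowerSeries.X := by
    rw [map_mul, map_ofNat, posEmb, PowerSeries.map_X]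
  rw [map_mul, map_pow, map_pow, map_pow, h1, posEmb_C_risePoly, Nat.cast_mul, ← monomialX_pow,
    twoTA₁]
  ring

theorem posEmb_C_eq_negEmb (p : ℝ[X]) :
    posEmb (PowerSeries.C p) = monomialX p.natDegree * negEmb (PowerSeries.C p.reverse) := by
  rw [← swapX_posEmb, posEmb, PowerSeries.map_C, PowerSeries.map_C, swapX, PowerSeries.map_C,
    monomialX, ← map_mul]
  congr 1
  change _ = _ * LaurentPolynomial.invert _
  rw [LaurentPolynomial.toLaurent_reverse, map_mul, LaurentPolynomial.involutive_invert,
    LaurentPolynomial.invert_T, mul_comm, mul_assoc, ← LaurentPolynomial.T_add, neg_add_cancel,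
    LaurentPolynomial.T_zero, mul_one]

theorem expansionRing_anti {k : Subfield SeriesT} {Z Z' : Set ℂ} (h : Z ⊆ Z') :
    expansionRing k Z' ≤ expansionRing k Z := fun _ hf =>
  mem_expansionRing.mpr fun α hα => mem_expansionRing.mp hf α (h hα)

variable {A : Finset (ℤ × ℤ)} {k : Subfield SeriesT}

/-- If `(2tA₁)ʲ P` and `f⁺` differ by a series `g`, where `P` and `f⁺` have no poles in `x`
except `0`, and if `g` and `f⁻` differ by a multiple of `(2tA₁)ʲ` with small degree in `x`,
then the coefficients of `g` belong to any field over which `f⁺` and `f⁻` can be expanded. -/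
theorem laurentCoeff_mem_of_congruent (j : ℕ) (hZ : ∀ α ∈ rootsA₁ A, (HahnSeries.C α : SeriesT) ∈ k)
    (hV : PowerSeries.C Polynomial.X ∈ expansionRing k (insert 0 (rootsA₁ A)))
    {f f' g : PowerSeries ℝ[T;T⁻¹]} {p m : PowerSeries ℝ[X]}
    (hf : f ∈ laurentRing (expansionRing k (insert 0 (rootsA₁ A))) hV)
    (hf' : f' ∈ swapRing (expansionRing k {0}) (C_X_mem_expansionRing_zero k))
    (hg : g = f - twoTA₁ A ^ j * posEmb p)
    (hg' : g = f' + twoTA₁ A ^ j * (monomialX (-1) * negEmb m))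
    {B : ℕ} (hB : ∀ i : ℤ, B < i → laurentCoeff i g = 0) (i : ℤ) :
    ofRealSeriesHom (laurentCoeff i g) ∈ k := by
  -- The degenerate case `A₁ = 0`, `j > 0`, where `g` is `f` itself.
  by_cases h0 : twoTA₁ A ^ j = 0
  · rw [hg, h0, zero_mul, sub_zero]
    exact laurentCoeff_mem (hV := C_X_mem_expansionRing_zero k)
      (laurentRing_mono (expansionRing_anti (by simp)) hf) i
  obtain ⟨N, H, hH, hNf⟩ := hf
  set w := risePoly ℝ A ^ j with hw
  have hw0 : w ≠ 0 := by
    intro hw0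
    have h1 := twoTA₁_pow_eq A j
    rw [← hw, hw0, map_zero, mul_zero, map_zero] at h1
    have h2 := congrArg (monomialX (-((j * stepBound A : ℕ) : ℤ)) * ·) h1
    simp only [← mul_assoc, monomialX_neg_mul, one_mul, mul_zero] at h2
    exact h0 h2
  set M := j * stepBound A with hM
  set W : ℝ[X] := Polynomial.X ^ N * w with hW
  set H' := PowerSeries.C Polynomial.X ^ M * H with hH'
  set R := (2 * PowerSeries.X) ^ j * p with hR
  -- The interpolated polynomial is `x^(N+M) g`: the factor `x^N` clears the poles of `f` at `0`,
  -- and `x^M` those of `A₁ʲ`. The modulus is `W = x^N (x^(M/j) A₁)ʲ` when `j > 0`.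
  have hGs : posEmb (H' - PowerSeries.C W * R) = monomialX ((N + M : ℕ) : ℤ) * g := by
    have h1 := twoTA₁_pow_eq A j
    rw [map_mul] at h1
    rw [hg, hH', hW, hR, map_sub, map_mul, map_mul, map_mul, map_mul, map_mul, Nat.cast_add,
      monomialX_add, ← map_pow PowerSeries.C, ← monomialX_natCast, ← monomialX_natCast, ← hNf]
    linear_combination (monomialX (N : ℤ) * posEmb p) * h1
  obtain ⟨G, hG, hGc⟩ := exists_polynomial_expand (f := H' - PowerSeries.C W * R)
    (N := N + M + B) fun l hl => by
      rw [hGs, laurentCoeff_monomialX_mul]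
      exact hB _ (by push_cast at hl ⊢; omega)
  have hWmap : W.map (HahnSeries.C.comp Complex.ofRealHom : ℝ →+* SeriesT) =
      (W.map Complex.ofRealHom).map (HahnSeries.C : ℂ →+* SeriesT) := by
    rw [Polynomial.map_map]
  have hWC : W.map Complex.ofRealHom = Polynomial.X ^ N * risePoly ℂ A ^ j := by
    rw [hW, hw, Polynomial.map_mul, Polynomial.map_pow, Polynomial.map_pow, Polynomial.map_X,
      map_risePoly]
  have hsplit := IsAlgClosed.splits (W.map Complex.ofRealHom)
  have key := coeff_mem_of_congruent (k := k) (G := G)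
    (W := W.map (HahnSeries.C.comp Complex.ofRealHom : ℝ →+* SeriesT)) ?_ ?_ ?_ ?_
  · have h1 : laurentCoeff i g =
        laurentCoeff (i + (N + M : ℕ)) (posEmb (H' - PowerSeries.C W * R)) := by
      rw [hGs, laurentCoeff_monomialX_mul, add_sub_cancel_right]
    rw [h1]
    rcases lt_or_ge (i + (N + M : ℕ)) 0 with hi | hi
    · rw [laurentCoeff_posEmb_of_neg _ hi, map_zero]
      exact zero_mem _
    · obtain ⟨n, hn⟩ := Int.eq_ofNat_of_zero_le hi
      rw [hn, ← hGc]
      exact key n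
  · intro n
    have h1 : W.map (HahnSeries.C.comp Complex.ofRealHom : ℝ →+* SeriesT) =
        (Polynomial.X ^ N * risePoly k A ^ j).map k.subtype := by
      rw [hWmap, hWC, Polynomial.map_mul, Polynomial.map_mul, Polynomial.map_pow,
        Polynomial.map_pow, Polynomial.map_pow, Polynomial.map_pow, Polynomial.map_X,
        Polynomial.map_X, map_risePoly, map_risePoly]
    rw [h1, Polynomial.coeff_map]
    exact SetLike.coe_mem _
  · rw [hWmap]
    exact hsplit.map _
  -- High degrees: exponents in `Tʲ S_j⁻` are at most `deg w - M - 1`, so after the shift by `N + M`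
  -- they stay below `deg W = N + deg w`. Only `f'` contributes.
  · intro n hn
    rw [Polynomial.natDegree_map, hW, Polynomial.natDegree_mul (pow_ne_zero _ Polynomial.X_ne_zero)
      hw0, Polynomial.natDegree_X_pow] at hn
    rw [hGc, hGs, laurentCoeff_monomialX_mul, hg', map_add, map_add]
    refine add_mem ?_ ?_
    · have h1 := laurentCoeff_mem (mem_swapRing.mp hf') (-((n : ℤ) - (N + M : ℕ)))
      rwa [laurentCoeff_swapX, neg_neg] at h1
    · have h1 : twoTA₁ A ^ j * (monomialX (-1) * negEmb m) =
          monomialX (-(M : ℤ) + w.natDegree + -1) * negEmb ((2 * PowerSeries.X) ^ j *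
            PowerSeries.C w.reverse * m) := by
        have h2 := twoTA₁_pow_eq A j
        rw [map_mul, ← hw, posEmb_C_eq_negEmb] at h2
        have h3 : negEmb ((2 * PowerSeries.X : PowerSeries ℝ[X]) ^ j) =
            posEmb ((2 * PowerSeries.X) ^ j) := by
          rw [← swapX_posEmb, map_pow, map_pow, map_mul, map_ofNat, posEmb, PowerSeries.map_X,
            map_mul, map_ofNat, swapX_X]
        rw [map_mul, map_mul, h3, monomialX_add, monomialX_add]
        linear_combination (monomialX (-(M : ℤ)) * monomialX (-1) * negEmb m) * h2 -
          (twoTA₁ A ^ j * monomialX (-1) * negEmb m) * monomialX_neg_mul (F := ℝ) M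
      rw [h1, laurentCoeff_monomialX_mul, laurentCoeff_negEmb_of_pos, map_zero]
      · exact zero_mem _
      · push_cast
        omega
  -- The roots of `W` are complex constants, each `0` or a root of `A₁`. There `H'` expands over
  -- `k`, and the rest of `G` is a multiple of `W`.
  · intro β hβ
    have hβ' : β ∈ (W.map (HahnSeries.C.comp Complex.ofRealHom : ℝ →+* SeriesT)).roots := by
      rw [Polynomial.mem_roots', Polynomial.map_ne_zero_iff (RingHom.injective _)]
      exact ⟨mul_ne_zero (pow_ne_zero _ Polynomial.X_ne_zero) hw0, hβ⟩
    rw [hWmap, hsplit.roots_map, Multiset.mem_map] at hβ'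
    obtain ⟨α, hα, rfl⟩ := hβ'
    have hroot := Polynomial.isRoot_of_mem_roots hα
    rw [hWC, Polynomial.IsRoot, Polynomial.eval_mul, Polynomial.eval_pow, Polynomial.eval_pow,
      Polynomial.eval_X] at hroot
    have hαZ : α ∈ insert 0 (rootsA₁ A) := by
      by_cases hα0 : α = 0
      · exact Or.inl hα0
      · refine Or.inr ?_
        have h1 := (mul_eq_zero.mp hroot).resolve_left (pow_ne_zero _ hα0)
        have hj : j ≠ 0 := by
          rintro rfl
          rw [pow_zero] at h1
          exact one_ne_zero h1
        have h2 := (pow_eq_zero_iff hj).mp h1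
        rw [eval_risePoly A hα0] at h2
        refine ⟨fun h3 => h0 ?_, hα0, (mul_eq_zero.mp h2).resolve_left (pow_ne_zero _ hα0)⟩
        rw [twoTA₁, (A₁_eq_zero_iff A).mp h3, map_zero, mul_zero, zero_pow hj]
    refine ⟨?_, expand α H', ?_, -expand α R, ?_⟩
    · rcases hαZ with rfl | hαZ
      · rw [map_zero]
        exact zero_mem _
      · exact hZ α hαZ
    · exact mem_expansionRing.mp (mul_mem (pow_mem hV _) hH) α hαZ
    · rw [hG, map_sub, map_mul (expand α) (PowerSeries.C W), expand_C]
      ring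

end Interpolation

/-! ### The theorem -/

section Conclusion

variable {A : Finset (ℤ × ℤ)} {F : Triple}

theorem tT_mem_QA : tT ∈ (QA A F).toSubfield :=
  (QA A F).algebraMap_mem ⟨tT, tT_mem_QT⟩

theorem sqrt_D_mem_QA : ofRealSeries (sqrtSeries F.D) ∈ (QA A F).toSubfield :=
  IntermediateField.subset_adjoin _ _ (Or.inl (Or.inl (Or.inl (Or.inl rfl))))

theorem xCoeff_Delta_mem_QA (i : ℕ) : ofRealSeries (xCoeff i F.Delta) ∈ (QA A F).toSubfield :=
  IntermediateField.subset_adjoin _ _ (Or.inl (Or.inl (Or.inl (Or.inr ⟨i, rfl⟩))))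

theorem xCoeff_DeltaBar_mem_QA (i : ℕ) :
    ofRealSeries (xCoeff i F.DeltaBar) ∈ (QA A F).toSubfield :=
  IntermediateField.subset_adjoin _ _ (Or.inl (Or.inl (Or.inr ⟨i, rfl⟩)))

theorem root_mem_QA {α : ℂ} (hα : α ∈ rootsA₁ A) :
    (HahnSeries.C α : SeriesT) ∈ (QA A F).toSubfield :=
  IntermediateField.subset_adjoin _ _ (Or.inl (Or.inr ⟨α, hα, rfl⟩))

theorem sqrt_evalAt_mem_QA {α : ℂ} (hα : α ∈ rootsA₁ A) :
    ((sqrtSeries (evalAt α F.Delta) : PowerSeries ℂ) : LaurentSeries ℂ) ∈ (QA A F).toSubfield :=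
  IntermediateField.subset_adjoin _ _ (Or.inr ⟨α, hα, rfl⟩)

theorem laurentCoeff_posEmb_mem {k : Subfield SeriesT} {f : PowerSeries ℝ[X]}
    (hf : ∀ i, ofRealSeries (xCoeff i f) ∈ k) (i : ℤ) :
    ofRealSeriesHom (laurentCoeff i (posEmb f)) ∈ k := by
  rcases lt_or_ge i 0 with hi | hi
  · rw [laurentCoeff_posEmb_of_neg _ hi, map_zero]
    exact zero_mem _
  · lift i to ℕ using hi
    rw [← xCoeff_eq_laurentCoeff]
    exact hf i

theorem evalAt_zero (f : PowerSeries ℝ[X]) : evalAt 0 f =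
    PowerSeries.map Complex.ofRealHom (PowerSeries.map (Polynomial.evalRingHom 0) f) := by
  ext n
  rw [evalAt, PowerSeries.coeff_map, PowerSeries.coeff_map, PowerSeries.coeff_map,
    Polynomial.coe_eval₂RingHom, Polynomial.coe_evalRingHom]
  simpa using Polynomial.eval₂_at_apply (p := PowerSeries.coeff n f) Complex.ofRealHom 0

theorem zero_or_root_mem_QA : ∀ α ∈ insert 0 (rootsA₁ A),
    (HahnSeries.C α : SeriesT) ∈ (QA A F).toSubfield := by
  rintro α (rfl | hα)
  · rw [map_zero]
    exact zero_mem _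
  · exact root_mem_QA hα

/-- At the roots of `A₁` the values of `√Δ` are generators of `ℚ_A`; at `0` the value is `1`. -/
theorem IsCanonicalFactorization.rootPos_mem (hF : IsCanonicalFactorization A F) :
    rootPos F ∈ expansionRing (QA A F).toSubfield (insert 0 (rootsA₁ A)) := by
  obtain ⟨N, hN, -⟩ := hF.exists_bound
  refine sqrt_mem_expansionRing ?_ hF.constantCoeff_rootPos ?_
  · rw [hF.rootPos_sq]
    exact mem_expansionRing_of_bounded zero_or_root_mem_QA hN
      (laurentCoeff_posEmb_mem xCoeff_Delta_mem_QA)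
  · rintro α (rfl | hα)
    · rw [evalAt_zero, hF.rootPos_x_zero, map_one, map_one]
      exact one_mem _
    · have h1 : evalAt α (rootPos F) = sqrtSeries (evalAt α F.Delta) :=
        map_sqrtSeries _ hF.Delta_t_zero
      rw [h1]
      exact sqrt_evalAt_mem_QA hα

/-- The value of `√(DΔ̄)` at `x̄ = 0` is `√D`, whence the generator `√D`. -/
theorem IsCanonicalFactorization.rootNeg_mem (hF : IsCanonicalFactorization A F) :
    rootNeg F ∈ expansionRing (QA A F).toSubfield {0} := by
  refine sqrt_mem_expansionRing ?_ hF.constantCoeff_rootNeg ?_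
  · rw [hF.rootNeg_sq]
    refine mul_mem (map_C_mem_expansionRing ?_)
      (mem_expansionRing_zero.mpr (laurentCoeff_posEmb_mem xCoeff_DeltaBar_mem_QA))
    rw [← sqrtSeries_sq hF.D_zero, ← ofRealSeriesHom_apply, map_pow, ofRealSeriesHom_apply]
    exact pow_mem sqrt_D_mem_QA 2
  · rintro α rfl
    rw [evalAt_zero, hF.rootNeg_x_zero]
    exact sqrt_D_mem_QA

theorem exists_ofLaurentPoly_eq {g : PowerSeries ℝ[T;T⁻¹]} {N : ℕ}
    (hlow : ∀ i : ℤ, i < -N → laurentCoeff i g = 0) (hup : ∀ i : ℤ, N < i → laurentCoeff i g = 0)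
    (hg : ∀ i, ofRealSeriesHom (laurentCoeff i g) ∈ (QA A F).toSubfield) :
    ∃ p : LaurentPolynomial (QA A F), ofLaurentPoly p = toSeriesXT g := by
  have hsupp : ∀ i : ℤ, laurentCoeff i g ≠ 0 → i ∈ Finset.Icc (-N : ℤ) N := fun i hi => by
    rw [Finset.mem_Icc]
    by_contra hcon
    rcases (by omega : i < -N ∨ (N : ℤ) < i) with h | h
    · exact hi (hlow i h)
    · exact hi (hup i h)
  have hsupp' : ∀ i, (⟨ofRealSeriesHom (laurentCoeff i g), hg i⟩ : QA A F) ≠ 0 →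
      i ∈ Finset.Icc (-N : ℤ) N := fun i hi => hsupp i fun h0 => hi (Subtype.ext (by
    change ofRealSeriesHom (laurentCoeff i g) = 0
    rw [h0, map_zero]))
  let p : LaurentPolynomial (QA A F) := .ofCoeff (Finsupp.onFinset (Finset.Icc (-N : ℤ) N)
    (fun i => (⟨ofRealSeriesHom (laurentCoeff i g), hg i⟩ : QA A F)) hsupp')
  have hp : ∀ i, (p.coeff i : SeriesT) = ofRealSeriesHom (laurentCoeff i g) := fun i => rfl
  have hgsum : g = ∑ i ∈ Finset.Icc (-N : ℤ) N, constEmb (laurentCoeff i g) * monomialX i := by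
    refine ext_laurentCoeff fun l => ?_
    have h1 : ∀ i : ℤ, laurentCoeff l (constEmb (laurentCoeff i g) * monomialX i) =
        if l = i then laurentCoeff i g else 0 := fun i => by
      rw [mul_comm, laurentCoeff_monomialX_mul, laurentCoeff_constEmb]
      simp only [sub_eq_zero]
    rw [map_sum]
    simp only [h1, Finset.sum_ite_eq]
    split_ifs with h
    · rfl
    · by_contra hcon
      exact h (hsupp l hcon)
  refine ⟨p, ?_⟩
  conv_rhs => rw [hgsum]
  rw [ofLaurentPoly, map_sum]
  have h2 : p.coeff.support ⊆ Finset.Icc (-N : ℤ) N :=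
    Finsupp.support_onFinset_subset (hf := hsupp')
  refine (Finset.sum_congr rfl fun i _ => ?_).trans (Finset.sum_subset h2 fun i _ hi => ?_)
  · rw [map_mul, toSeriesXT_constEmb, toSeriesXT_monomialX, hp]
    rfl
  · rw [Finsupp.notMem_support_iff] at hi
    have h3 := hp i
    rw [hi] at h3
    have h4 : laurentCoeff i g = 0 := (map_eq_zero_iff _ ofRealSeriesHom_injective).mp h3.symm
    rw [h4, map_zero, zero_mul, map_zero]

theorem walkSeries_eq_zero (hA : Symmetric A) (hA' : SmallHeightVariations A) {j : ℤ} (hj : j ≠ 0)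
    (h : twoTA₁ A = 0) : walkSeries A j = 0 := by
  have h1 := levelKernel_mul_walkSeries hA hA' hj
  rw [h, zero_mul] at h1
  exact (isUnit_two_mul_levelKernel A).mul_right_eq_zero.mp h1

theorem mul_eq_div_of_mul_eq_one {K : Type*} [Field K] {a b : K} (c : K) (h : a * b = 1) :
    c * b = c / a := by
  rw [eq_div_iff (left_ne_zero_of_mul_eq_one h), mul_assoc, mul_comm b, h, mul_one]

theorem toSeriesXT_fPlusSeries_mul {f : PowerSeries ℝ[T;T⁻¹]}
    (hf : posEmb (rootPos F) * f = 1) (j : ℕ) :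
    toSeriesXT (fPlusSeries A j * f) = fPlus A j / sqrtDelta F := by
  have h1 : sqrtDelta F * toSeriesXT f = 1 := by
    rw [sqrtDelta, ← rootPos, ← toSeriesXT_posEmb, ← map_mul, hf, map_one]
  rw [map_mul, toSeriesXT_fPlusSeries]
  exact mul_eq_div_of_mul_eq_one (K := SeriesXT) _ h1

/-- Once `g` is over `k`, so are `Tʲ S_j⁺ = f - g` and `Tʲ S_j⁻ = g - f'`, and `Tʲ ≠ 0` can be
divided out, after `x ↦ x⁻¹` for the second. -/
theorem mem_expansionRing_of_parts {k : Subfield SeriesT} {j : ℕ} (h0 : twoTA₁ A ^ j ≠ 0)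
    (hX : PowerSeries.X ∈ expansionRing k {0})
    {f f' g : PowerSeries ℝ[T;T⁻¹]} {p m : PowerSeries ℝ[X]}
    (hf : f ∈ laurentRing (expansionRing k {0}) (C_X_mem_expansionRing_zero k))
    (hf' : f' ∈ swapRing (expansionRing k {0}) (C_X_mem_expansionRing_zero k))
    (hg : g = f - twoTA₁ A ^ j * posEmb p)
    (hg' : g = f' + twoTA₁ A ^ j * (monomialX (-1) * negEmb m))
    {N : ℕ} (hlow : ∀ i : ℤ, i < -N → laurentCoeff i g = 0)
    (hup : ∀ i : ℤ, N < i → laurentCoeff i g = 0)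
    (hgk : ∀ i, ofRealSeriesHom (laurentCoeff i g) ∈ k) :
    p ∈ expansionRing k {0} ∧ m ∈ expansionRing k {0} := by
  constructor
  · refine mem_laurentRing_of_mul_mem (hV := C_X_mem_expansionRing_zero k) (f := twoTA₁ A ^ j)
      (pow_mem (twoTA₁_mem (fun i => monomialX_mem_laurentRing i) (X_mem_laurentRing hX) A) j)
      h0 ?_
    have h1 : twoTA₁ A ^ j * posEmb p = f - g := by
      rw [hg]
      ring
    rw [h1]
    exact sub_mem hf (mem_laurentRing_of_laurentCoeff_mem _ hlow hgk)
  · have h1 : swapX (twoTA₁ A ^ j * monomialX (-1)) * posEmb m = swapX g - swapX f' := by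
      rw [← swapX_negEmb, ← map_mul, ← map_sub, hg']
      congr 1
      ring
    have h2 : twoTA₁ A ^ j * monomialX (-1) ∈
        swapRing (expansionRing k {0}) (C_X_mem_expansionRing_zero k) :=
      mul_mem (pow_mem (twoTA₁_mem (fun i => monomialX_mem_swapRing i) (X_mem_swapRing hX) A) j)
        (monomialX_mem_swapRing _)
    refine mem_laurentRing_of_mul_mem (mem_swapRing.mp h2) ?_ ?_
    · rw [map_ne_zero_iff _ swapX_injective]
      exact mul_ne_zero h0 (left_ne_zero_of_mul_eq_one (monomialX_neg_mul 1))
    · rw [h1]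
      refine sub_mem (mem_laurentRing_of_laurentCoeff_mem N (fun i hi => ?_) fun i => ?_)
        (mem_swapRing.mp hf')
      · rw [laurentCoeff_swapX]
        exact hup _ (by omega)
      · rw [laurentCoeff_swapX]
        exact hgk _

/-- The identities for `S_j⁺` and `S_j⁻`, together with the rationality over `ℚ_A` of the
coefficients of `S_j`. -/
theorem exists_gSeries (hA : Symmetric A) (hA' : SmallHeightVariations A)
    (hF : IsCanonicalFactorization A F) (j : ℕ) :
    (∃ g : LaurentPolynomial (QA A F),
      (2 * t * A₁ A) ^ j * SPlus A j = fPlus A j / sqrtDelta F - ofLaurentPoly g ∧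
      (2 * t * A₁ A) ^ j * SMinus A j = ofLaurentPoly g - fMinus A j * sqrtDDeltaBar F) ∧
    ∀ i : ℤ, ofRealSeriesHom (laurentCoeff i (walkSeries A j)) ∈ (QA A F).toSubfield := by
  set k := (QA A F).toSubfield with hk
  have hV : PowerSeries.C Polynomial.X ∈ expansionRing k (insert 0 (rootsA₁ A)) :=
    C_X_mem_expansionRing zero_or_root_mem_QA
  have hV0 := C_X_mem_expansionRing_zero k
  have htk : tT ∈ k := tT_mem_QA
  obtain ⟨s, hs, -⟩ := exists_walkSeries_zero_eq_posEmb A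
  have hPs := posEmb_rootPos_mul_walkSeries hA hA' hF
  have hsmem : s ∈ expansionRing k (insert 0 (rootsA₁ A)) := by
    refine inv_mem_expansionRing hF.rootPos_mem (posEmb_injective ?_)
    rw [map_mul, ← hs, hPs, map_one]
  obtain ⟨p, m, hpm, hp, hm⟩ := exists_walkSeries_split A j
  have hmain := twoTA₁_pow_mul_walkSeries_eq hA hA' hF j
  set f := fPlusSeries A j * walkSeries A 0 with hf
  set f' := fMinusSeries A j * negEmb (rootNeg F) with hf'
  set g := f - twoTA₁ A ^ j * posEmb p with hg
  have hg' : g = f' + twoTA₁ A ^ j * (monomialX (-1) * negEmb m) := by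
    rw [hpm] at hmain
    rw [hg]
    linear_combination -hmain
  have hfmem : f ∈ laurentRing (expansionRing k (insert 0 (rootsA₁ A))) hV := by
    rw [hf, hs]
    exact mul_mem (fPlusSeries_mem (fun i => monomialX_mem_laurentRing i)
      (X_mem_laurentRing (X_mem_expansionRing htk)) A j) (posEmb_mem_laurentRing hsmem)
  have hfmem' : f' ∈ swapRing (expansionRing k {0}) hV0 :=
    mul_mem (fMinusSeries_mem (fun i => monomialX_mem_swapRing i)
      (X_mem_swapRing (X_mem_expansionRing htk)) A j) (negEmb_mem_swapRing hF.rootNeg_mem)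
  -- From `f - Tʲ S_j⁺` the exponents of `g` are bounded below; from `f' + Tʲ S_j⁻` they are bounded
  -- above.
  have hglow : g ∈ laurentRing ⊤ (Subring.mem_top _) :=
    sub_mem (laurentRing_mono le_top hfmem) (mul_mem (pow_mem (twoTA₁_mem
      (fun i => monomialX_mem_laurentRing i) (X_mem_laurentRing (Subring.mem_top _)) A) j)
      (posEmb_mem_laurentRing (Subring.mem_top _)))
  have hgup : g ∈ swapRing ⊤ (Subring.mem_top _) := by
    rw [hg']
    refine add_mem (laurentRing_mono (hW := Subring.mem_top _) le_top (mem_swapRing.mp hfmem'))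
      (mul_mem (pow_mem (twoTA₁_mem
      (fun i => monomialX_mem_swapRing i) (X_mem_swapRing (Subring.mem_top _)) A) j)
      (mul_mem (monomialX_mem_swapRing _) (negEmb_mem_swapRing (Subring.mem_top _))))
  obtain ⟨N, hN⟩ := exists_lower_bound hglow
  obtain ⟨B, hB⟩ := exists_upper_bound hgup
  have hgk : ∀ i, ofRealSeriesHom (laurentCoeff i g) ∈ k :=
    laurentCoeff_mem_of_congruent j (fun α hα => root_mem_QA hα) hV hfmem hfmem' hg hg' hB
  have hN' : ∀ i : ℤ, i < -(max N B : ℕ) → laurentCoeff i g = 0 := fun i hi =>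
    hN i (by omega)
  have hB' : ∀ i : ℤ, (max N B : ℕ) < i → laurentCoeff i g = 0 := fun i hi =>
    hB i (by omega)
  refine ⟨?_, fun i => ?_⟩
  · obtain ⟨q, hq⟩ := exists_ofLaurentPoly_eq hN' hB' hgk
    have hdelta' := toSeriesXT_fPlusSeries_mul (A := A) hPs j
    have hbar : toSeriesXT f' = fMinus A j * sqrtDDeltaBar F := by
      rw [hf', map_mul, toSeriesXT_fMinusSeries, toSeriesXT_negEmb, sqrtDDeltaBar, rootNeg]
    refine ⟨q, ?_, ?_⟩
    · rw [hq, ← hp, ← hdelta', ← toSeriesXT_twoTA₁, ← map_pow, ← map_mul, ← map_sub]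
      congr 1
      rw [hg]
      ring
    · rw [hq, ← hm, ← hbar, ← toSeriesXT_twoTA₁, ← map_pow, ← map_mul, ← map_sub]
      congr 1
      rw [hg']
      ring
  -- If `A₁ = 0` and `j > 0`, division by `Tʲ` is impossible, but no walk leaves the axis and `S_j =
  -- 0`.
  · by_cases h0 : twoTA₁ A ^ j = 0
    · have hj : j ≠ 0 := by
        rintro rfl
        rw [pow_zero] at h0
        exact one_ne_zero h0
      rw [walkSeries_eq_zero hA hA' (by exact_mod_cast hj) ((pow_eq_zero_iff hj).mp h0), map_zero,
        map_zero]
      exact zero_mem _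
    · obtain ⟨hpmem, hmmem⟩ := mem_expansionRing_of_parts h0 (X_mem_expansionRing htk)
        (laurentRing_mono (hW := hV0) (expansionRing_anti (by simp)) hfmem) hfmem' hg hg'
        hN' hB' hgk
      rw [hpm, map_add, map_add, laurentCoeff_monomialX_mul, ← swapX_posEmb, laurentCoeff_swapX]
      exact add_mem (mem_expansionRing_zero.mp hpmem i) (mem_expansionRing_zero.mp hmmem _)

theorem S_mem_QA (hA : Symmetric A) (hA' : SmallHeightVariations A)
    (hF : IsCanonicalFactorization A F) (i j : ℤ) : S A i j ∈ QA A F := by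
  have h1 : walkSeries A j = walkSeries A (j.natAbs : ℤ) := by
    rcases Int.natAbs_eq j with h | h
    · rw [← h]
    · conv_lhs => rw [h]
      exact walkSeries_neg hA _
  rw [S_eq_ofRealSeriesHom, h1]
  exact (exists_gSeries hA hA' hF j.natAbs).2 i

theorem two_mul_t_mul_A₁_pow_ne_zero (hA : A₁ A ≠ 0) (j : ℕ) : (2 * t * A₁ A) ^ j ≠ 0 := by
  rw [← toSeriesXT_twoTA₁, ← map_pow, map_ne_zero_iff _ toSeriesXT_injective]
  refine pow_ne_zero _ (fun h => hA ?_)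
  rw [twoTA₁] at h
  have h2 : (2 : PowerSeries ℝ[T;T⁻¹]) ≠ 0 := fun h2 =>
    (isUnit_two_mul_levelKernel A).ne_zero (by rw [h2, zero_mul])
  have h3 := (mul_eq_zero.mp h).resolve_left (mul_ne_zero h2 PowerSeries.X_ne_zero)
  rw [A₁_eq_zero_iff]
  exact (map_eq_zero_iff _ PowerSeries.C_injective).mp h3

theorem eq_mul_div_cancel_left {K : Type*} [Field K] {a : K} (ha : a ≠ 0) (b : K) :
    b = a * b / a := (mul_div_cancel_left₀ b ha).symm

theorem isAlgebraic_of_mem_QA (hF : IsCanonicalFactorization A F) {a : SeriesT}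
    (ha : a ∈ QA A F) : IsAlgebraic QT a := by
  have := hF.finiteDimensional_QA
  have h1 : IsIntegral QT (⟨a, ha⟩ : QA A F) := IsIntegral.of_finite QT _
  exact (h1.map (QA A F).val).isAlgebraic

end Conclusion

end

end SlitPlane

theorem mainTheorem4 (A : Finset (ℤ × ℤ)) (hsymm : SlitPlane.Symmetric A)
    (hsmall : SlitPlane.SmallHeightVariations A) :
    (∃! F : SlitPlane.Triple, SlitPlane.IsCanonicalFactorization A F) ∧
    ∀ F : SlitPlane.Triple, SlitPlane.IsCanonicalFactorization A F →
      FiniteDimensional SlitPlane.QT (SlitPlane.QA A F) ∧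
      (∀ j : ℕ, ∃ g : LaurentPolynomial (SlitPlane.QA A F),
        ((2 * SlitPlane.t * SlitPlane.A₁ A) ^ j * SlitPlane.SPlus A j =
            SlitPlane.fPlus A j / SlitPlane.sqrtDelta F - SlitPlane.ofLaurentPoly g ∧
          (2 * SlitPlane.t * SlitPlane.A₁ A) ^ j * SlitPlane.SMinus A j =
            SlitPlane.ofLaurentPoly g - SlitPlane.fMinus A j * SlitPlane.sqrtDDeltaBar F) ∧
        (SlitPlane.A₁ A ≠ 0 →
          SlitPlane.SPlus A j =
            (SlitPlane.fPlus A j / SlitPlane.sqrtDelta F - SlitPlane.ofLaurentPoly g) /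
              (2 * SlitPlane.t * SlitPlane.A₁ A) ^ j ∧
          SlitPlane.SMinus A j =
            (SlitPlane.ofLaurentPoly g - SlitPlane.fMinus A j * SlitPlane.sqrtDDeltaBar F) /
              (2 * SlitPlane.t * SlitPlane.A₁ A) ^ j)) ∧
      (∀ i j : ℤ, SlitPlane.S A i j ∈ SlitPlane.QA A F ∧
        IsAlgebraic SlitPlane.QT (SlitPlane.S A i j)) := by
  refine ⟨SlitPlane.existsUnique_canonicalFactorization A, fun F hF => ?_⟩
  refine ⟨hF.finiteDimensional_QA, fun j => ?_, fun i j => ?_⟩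
  · obtain ⟨⟨g, hplus, hminus⟩, -⟩ := SlitPlane.exists_gSeries hsymm hsmall hF j
    refine ⟨g, ⟨hplus, hminus⟩, fun hA => ?_⟩
    have h0 := SlitPlane.two_mul_t_mul_A₁_pow_ne_zero hA j
    rw [← hplus, ← hminus]
    exact ⟨SlitPlane.eq_mul_div_cancel_left (K := SlitPlane.SeriesXT) h0 _,
      SlitPlane.eq_mul_div_cancel_left (K := SlitPlane.SeriesXT) h0 _⟩
  · have hS := SlitPlane.S_mem_QA hsymm hsmall hF i j
    exact ⟨hS, SlitPlane.isAlgebraic_of_mem_QA hF hS⟩
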